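/- Let $n\ge 1$ and let $|\cdot|$ be the Euclidean norm. For $\mu\in\mathbb R$ let $\mathcal F_E(\mu,\mathbb C^n)$ be the set of functions $g:\mathbb R\to\mathbb C^n$ of the form $g(t)=\sum_{\lambda\in S}p_\lambda(t)e^{\lambda t}$, where $S\subset\mathbb C$ is finite, $\operatorname{Re}\lambda=\mu$ for all $\lambda\in S$, and each $p_\lambda:\mathbb R\to\mathbb C^n$ is a polynomial; let $\mathcal F_E(\mu,\mathbb C^n,\mathbb R^n)$ be the set of those $g\in\mathcal F_E(\mu,\mathbb C^n)$ with $g(t)\in\mathbb R^n$ for all $t\in\mathbb R$. For a divergent, strictly increasing sequence $(\gamma_k)_{k\ge1}$ of nonnegative numbers and $g_k\in\mathcal F_E(-\gamma_k,\mathbb C^n)$, write $g(t)\sim\sum_{k=1}^\infty g_k(t)$ if for every $N\ge1$ there is $\nu>\gamma_N$ with $\bigl|g(t)-\sum_{k=1}^N g_k(t)\bigr|=\mathcal O(e^{-\nu t})$ as $t\to\infty$. Let $A$ be a real $n\times n$ matrix all of whose (complex) eigenvalues have positive real parts; denote the set of its eigenvalues by $\sigma(A)$. Let $G:\mathbb R^n\to\mathbb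 R^n$ be locally Lipschitz, and for $m\ge2$ let $G_m:\mathbb R^n\to\mathbb R^n$ be homogeneous polynomials of degree $m$ such that for every $N\ge2$ there is $\delta>0$ with $\bigl|G(x)-\sum_{m=2}^N G_m(x)\bigr|=\mathcal O(|x|^{N+\delta})$ as $x\to0$. For $m\ge 2$ let $\mathcal G_m:(\mathbb R^n)^m\to\mathbb R^n$ be an $m$-linear mapping with $G_m(x)=\mathcal G_m(x,\dots,x)$ for all $x\in\mathbb R^n$. Let $f$ be an $\mathbb R^n$-valued function that is continuous on $[T_f,\infty)$ for some $T_f\ge0$ and has an expansion $$f(t)\sim\sum_{k=1}^\infty f_k(t),\qquad f_k\in\mathcal F_E(-\mu_k,\mathbb C^n,\mathbb R^n)\text{ for } k\ge1,$$ where $(\mu_k)_{k\ge1}$ is a divergent, strictly increasing sequence of positive numbers such that the set $\{\mu_k:k\ge1\}$ is closed under addition and contains $\{\operatorname{Re}\lambda:\lambda\in\sigma(A)\}$. Let $T_0\ge0$ and let $y\in C^1((T_0,\infty),\mathbb R^n)$ be a solution of $$y'=-Ay+G(y)+f(t)\quad\text{on }(T_0,\infty)$$ with $y(t)\to0$ as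 $t\to\infty$. Then there exist functions $y_k\in\mathcal F_E(-\mu_k,\mathbb C^n,\mathbb R^n)$, $k\ge1$, such that $y(t)\sim\sum_{k=1}^\infty y_k(t)$, and such that for each $k\ge1$ $$y_k'+Ay_k=\sum_{m\ge2}\ \sum_{\mu_{j_1}+\mu_{j_2}+\dots+\mu_{j_m}=\mu_k}\mathcal G_m(y_{j_1},y_{j_2},\dots,y_{j_m})+f_k\qquad\text{on }\mathbb R,$$ where the inner sum runs over all $m$-tuples $(j_1,\dots,j_m)$ of positive integers with the indicated property (so the double sum is finite, and it is zero if there are no such tuples). -/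

import Mathlib

open Filter Topology Asymptotics Set

/-- A polynomial from `ℝ` to a complex vector space `X`. -/
def IsVecPolynomial {X : Type*} [AddCommGroup X] [Module ℂ X] (p : ℝ → X) : Prop :=
  ∃ (d : ℕ) (c : ℕ → X), ∀ t : ℝ, p t = ∑ i ∈ Finset.range d, ((t : ℂ) ^ i) • c i

/-- The class `F_E(μ, X)` of exponential polynomials `∑ p_z(t) exp (z t)`, where `z` ranges over a
finite set of complex numbers of real part `μ` and every `p_z` is an `X`-valued polynomial. -/
def ExpClass (μ : ℝ) (X : Type*) [AddCommGroup X] [Module ℂ X] : Set (ℝ → X) :=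
  {g | ∃ (S : Finset ℂ) (p : ℂ → ℝ → X),
    (∀ z ∈ S, z.re = μ) ∧ (∀ z ∈ S, IsVecPolynomial (p z)) ∧
      ∀ t : ℝ, g t = ∑ z ∈ S, Complex.exp (z * (t : ℂ)) • p z t}

/-- The inclusion of `ℝⁿ` into its complexification `ℂⁿ`. -/
def toComplexVec {n : ℕ} (x : EuclideanSpace ℝ (Fin n)) : EuclideanSpace ℂ (Fin n) :=
  WithLp.toLp 2 (fun i => ((x i : ℝ) : ℂ))

/-- The class `F_E(μ, ℂⁿ, ℝⁿ)` of the functions in `F_E(μ, ℂⁿ)` all of whose values lie in `ℝⁿ`.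
Such a function is given here as a function into `ℝⁿ`; the frequencies and the polynomial
coefficients of its representation may still be complex. -/
def RealExpClass (μ : ℝ) (n : ℕ) : Set (ℝ → EuclideanSpace ℝ (Fin n)) :=
  {g | (fun t => toComplexVec (g t)) ∈ ExpClass μ (EuclideanSpace ℂ (Fin n))}

/-- The asymptotic expansion `g(t) ∼ ∑ g_k(t)` with `g_k ∈ F_E(-γ_k, X)`, where `γ` is a divergent,
strictly increasing sequence of nonnegative numbers: the remainder after the term of index `N` is
`O(exp (-ν t))` as `t → ∞`, for some `ν > γ_N`. Sequences are indexed from `0`. -/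
def HasExpExpansion {X : Type*} [NormedAddCommGroup X] [NormedSpace ℂ X]
    (γ : ℕ → ℝ) (g : ℝ → X) (gs : ℕ → ℝ → X) : Prop :=
  (∀ k, 0 ≤ γ k) ∧ StrictMono γ ∧ Tendsto γ atTop atTop ∧
  (∀ k, gs k ∈ ExpClass (-γ k) X) ∧
  ∀ N : ℕ, ∃ ν : ℝ, γ N < ν ∧
    (fun t : ℝ => g t - ∑ k ∈ Finset.range (N + 1), gs k t)
      =O[atTop] (fun t : ℝ => Real.exp (-ν * t))

/-- The set of the eigenvalues, in `ℂ`, of a real square matrix. -/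
def complexSpectrum {n : ℕ} (A : Matrix (Fin n) (Fin n) ℝ) : Set ℂ :=
  spectrum ℂ (A.map (fun a : ℝ => (a : ℂ)))

/-- `P : ℝⁿ → ℝⁿ` is a homogeneous polynomial of degree `m`. -/
def IsHomogeneousPolyMap {n : ℕ} (m : ℕ)
    (P : EuclideanSpace ℝ (Fin n) → EuclideanSpace ℝ (Fin n)) : Prop :=
  ∃ q : Fin n → MvPolynomial (Fin n) ℝ, (∀ i, (q i).IsHomogeneous m) ∧
    ∀ x i, P x i = MvPolynomial.eval (fun j => x j) (q i)

/-- `G(x) ∼ ∑_{m ≥ 2} G_m(x)` as `x → 0`, with `G_m` a homogeneous polynomial of degree `m`. -/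
def HasPolyExpansionAtZero {n : ℕ}
    (G : EuclideanSpace ℝ (Fin n) → EuclideanSpace ℝ (Fin n))
    (Gm : ℕ → EuclideanSpace ℝ (Fin n) → EuclideanSpace ℝ (Fin n)) : Prop :=
  (∀ m, 2 ≤ m → IsHomogeneousPolyMap m (Gm m)) ∧
  ∀ N : ℕ, 2 ≤ N → ∃ δ : ℝ, 0 < δ ∧
    (fun x => G x - ∑ m ∈ Finset.Icc 2 N, Gm m x)
      =O[𝓝 0] (fun x => ‖x‖ ^ ((N : ℝ) + δ))

/-- The pairs of a number `m ≥ 2` and an `m`-tuple `(j_1, …, j_m)` of indices such that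
`μ_{j_1} + ⋯ + μ_{j_m} = μ_k`. -/
def sumIndices (μ : ℕ → ℝ) (k : ℕ) : Set (Σ m : ℕ, Fin m → ℕ) :=
  {p | 2 ≤ p.1 ∧ ∑ i, μ (p.2 i) = μ k}

/-- Sums over `sumIndices μ k` are finite sums. -/
theorem sumIndices_finite {μ : ℕ → ℝ} (hpos : ∀ k, 0 < μ k) (hmono : StrictMono μ) (k : ℕ) :
    (sumIndices μ k).Finite := by
  obtain ⟨M, hM⟩ := exists_nat_gt (μ k / μ 0)
  have hfin : (⋃ m ∈ Set.Iic M, (fun j => (⟨m, j⟩ : Σ m : ℕ, Fin m → ℕ)) ''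
      {j : Fin m → ℕ | ∀ i, j i ∈ Set.Iic k}).Finite := by
    refine (Set.finite_Iic M).biUnion fun m _ => Set.Finite.image _ ?_
    exact Set.Finite.pi' (fun _ => Set.finite_Iic k)
  refine hfin.subset ?_
  rintro ⟨m, j⟩ ⟨-, hj⟩
  simp only at hj
  have h1 : (m : ℝ) * μ 0 ≤ μ k := by
    rw [← hj]
    calc (m : ℝ) * μ 0 = ∑ _i : Fin m, μ 0 := by simp
      _ ≤ _ := Finset.sum_le_sum fun i _ => hmono.monotone (Nat.zero_le _)
  have h2 : m ≤ M := by
    have h3 : (m : ℝ) ≤ μ k / μ 0 := (le_div_iff₀ (hpos 0)).2 h1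
    exact_mod_cast h3.trans hM.le
  have h4 : ∀ i, j i ≤ k := fun i => by
    rw [← hmono.le_iff_le, ← hj]
    exact Finset.single_le_sum (f := fun i => μ (j i)) (fun i _ => (hpos _).le)
      (Finset.mem_univ i)
  simp only [Set.mem_iUnion]
  exact ⟨m, h2, j, h4, rfl⟩

/-! The terms are found one at a time. Suppose `y_k` is known for `k < N`, and that `w = y - ∑_{k<N}
y_k` is `O(exp (-ν t))` with `ν > μ_{N-1}`. Subtracting the equations of the `y_k` from that of `y`
gives `w' + A w = g + h`. Here `g` is the resonant sum of index `N` plus `f_N`, an exponential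
polynomial of rate `-μ_N`, and `h` decays strictly faster than `exp (-μ_N t)`. A solution `w` of
such an equation agrees, beyond order `exp (-μ_N t)`, with an exponential polynomial solution of
`y_N' + A y_N = g`; this is the next term.

Closure under addition is used twice. Every product of earlier terms has a rate in the set `{-μ_k}`,
so each one is resonant with index at most `N` or negligible. Moreover `μ_{N-1} + μ_0 ≥ μ_N`, so
replacing `y` by its partial sum inside a term of degree at least two costs only `o(exp (-μ_N t))`
(`nonlinear_expansion`). Since the `μ_k` contain the real parts of the eigenvalues, no mode of `A`
has its rate strictly between `μ_{N-1}` and `μ_N`. The linear step needs exactly this gap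
(`exists_real_exp_asymptotics`).

The linear theory is complex and avoids the Jordan form: a left eigenvector splits off one scalar
equation, and the rest lives on an invariant hyperplane (`exists_triangular_splitting`). The
recursion starts from decay at every rate below `μ_0` (`isBigO_exp_of_tendsto_zero`). -/

/-! ### Exponential polynomials -/

/-- The span of the functions `t ↦ exp (z t) t ^ i x` with `z` of real part `μ`. -/
def expSpan (μ : ℝ) (X : Type*) [AddCommGroup X] [Module ℂ X] : Submodule ℂ (ℝ → X) :=
  Submodule.span ℂ {g | ∃ (z : ℂ) (i : ℕ) (x : X), z.re = μ ∧
    g = fun t : ℝ => Complex.exp (z * t) • ((t : ℂ) ^ i • x)}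

section ExpSpan

variable {X Y : Type*} [AddCommGroup X] [Module ℂ X] [AddCommGroup Y] [Module ℂ Y] {μ ν : ℝ}

theorem monomial_mem_expSpan (z : ℂ) (hz : z.re = μ) (i : ℕ) (x : X) :
    (fun t : ℝ => Complex.exp (z * t) • ((t : ℂ) ^ i • x)) ∈ expSpan μ X :=
  Submodule.subset_span ⟨z, i, x, hz, rfl⟩

theorem IsVecPolynomial.add {p q : ℝ → X} (hp : IsVecPolynomial p) (hq : IsVecPolynomial q) :
    IsVecPolynomial (fun t => p t + q t) := by
  obtain ⟨d, c, h⟩ := hp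
  obtain ⟨d', c', h'⟩ := hq
  refine ⟨max d d', fun i => (if i < d then c i else 0) + (if i < d' then c' i else 0),
    fun t => ?_⟩
  have key : ∀ (e : ℕ) (b : ℕ → X), e ≤ max d d' →
      ∑ i ∈ Finset.range e, (t : ℂ) ^ i • b i =
        ∑ i ∈ Finset.range (max d d'), (t : ℂ) ^ i • (if i < e then b i else 0) := by
    intro e b he
    rw [← Finset.sum_subset (Finset.range_mono he)]
    · refine Finset.sum_congr rfl fun i hi => ?_
      rw [if_pos (Finset.mem_range.1 hi)]
    · intro i _ hi
      rw [if_neg (by simpa using hi), smul_zero]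
  simp only [smul_add, Finset.sum_add_distrib]
  rw [h, h', key d c (le_max_left _ _), key d' c' (le_max_right _ _)]

theorem IsVecPolynomial.const_smul {p : ℝ → X} (hp : IsVecPolynomial p) (a : ℂ) :
    IsVecPolynomial (fun t => a • p t) := by
  obtain ⟨d, c, h⟩ := hp
  refine ⟨d, fun i => a • c i, fun t => ?_⟩
  simp only [h, Finset.smul_sum]
  exact Finset.sum_congr rfl fun i _ => smul_comm _ _ _

theorem isVecPolynomial_zero : IsVecPolynomial (fun _ => (0 : X)) :=
  ⟨0, 0, fun t => by simp⟩

theorem isVecPolynomial_monomial (i : ℕ) (x : X) :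
    IsVecPolynomial (fun t : ℝ => (t : ℂ) ^ i • x) := by
  refine ⟨i + 1, fun j => if j = i then x else 0, fun t => ?_⟩
  rw [Finset.sum_eq_single i] <;> simp +contextual

theorem add_mem_ExpClass {g h : ℝ → X} (hg : g ∈ ExpClass μ X) (hh : h ∈ ExpClass μ X) :
    g + h ∈ ExpClass μ X := by
  classical
  obtain ⟨S, p, hS, hp, h1⟩ := hg
  obtain ⟨S', p', hS', hp', h2⟩ := hh
  refine ⟨S ∪ S', fun z t => (if z ∈ S then p z t else 0) + (if z ∈ S' then p' z t else 0),
    fun z hz => ?_, fun z _ => ?_, fun t => ?_⟩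
  · rcases Finset.mem_union.1 hz with h | h
    exacts [hS z h, hS' z h]
  · refine IsVecPolynomial.add (p := fun t => if z ∈ S then p z t else 0)
      (q := fun t => if z ∈ S' then p' z t else 0) ?_ ?_
    · by_cases h : z ∈ S
      · simpa [h] using hp z h
      · simpa [h] using isVecPolynomial_zero
    · by_cases h : z ∈ S'
      · simpa [h] using hp' z h
      · simpa [h] using isVecPolynomial_zero
  · simp only [smul_add, Finset.sum_add_distrib, Pi.add_apply, h1, h2]
    congr 1
    · rw [← Finset.sum_subset (Finset.subset_union_left (s₁ := S) (s₂ := S'))]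
      · exact Finset.sum_congr rfl fun z hz => by rw [if_pos hz]
      · intro z _ hz
        rw [if_neg hz, smul_zero]
    · rw [← Finset.sum_subset (Finset.subset_union_right (s₁ := S) (s₂ := S'))]
      · exact Finset.sum_congr rfl fun z hz => by rw [if_pos hz]
      · intro z _ hz
        rw [if_neg hz, smul_zero]

/-- Describing the class as a span lets closure properties be checked on the generators alone, by
span induction. -/
theorem mem_ExpClass_iff {g : ℝ → X} : g ∈ ExpClass μ X ↔ g ∈ expSpan μ X := by
  constructor
  · rintro ⟨S, p, hS, hp, h⟩
    have : g = ∑ z ∈ S, fun t : ℝ => Complex.exp (z * (t : ℂ)) • p z t := by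
      ext t
      simp [h t]
    rw [this]
    refine Submodule.sum_mem _ fun z hz => ?_
    obtain ⟨d, c, hc⟩ := hp z hz
    have : (fun t : ℝ => Complex.exp (z * (t : ℂ)) • p z t) = ∑ i ∈ Finset.range d,
        fun t : ℝ => Complex.exp (z * t) • ((t : ℂ) ^ i • c i) := by
      ext t
      simp [hc t, Finset.smul_sum]
    rw [this]
    exact Submodule.sum_mem _ fun i _ => monomial_mem_expSpan z (hS z hz) i _
  · intro h
    induction h using Submodule.span_induction with
    | mem g hg =>
      obtain ⟨z, i, x, hz, rfl⟩ := hg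
      exact ⟨{z}, fun _ t => (t : ℂ) ^ i • x, by simpa using hz,
        fun _ _ => isVecPolynomial_monomial i x, fun t => by simp⟩
    | zero => exact ⟨∅, 0, by simp, by simp, by simp⟩
    | add g h _ _ hg hh => exact add_mem_ExpClass hg hh
    | smul a g _ hg =>
      obtain ⟨S, p, hS, hp, h⟩ := hg
      refine ⟨S, fun z t => a • p z t, hS, fun z hz => (hp z hz).const_smul a, fun t => ?_⟩
      rw [Pi.smul_apply, h, Finset.smul_sum]
      exact Finset.sum_congr rfl fun z _ => smul_comm _ _ _

theorem fun_zero_mem_expSpan : (fun _ => (0 : X)) ∈ expSpan μ X := zero_mem _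

theorem fun_add_mem_expSpan {g h : ℝ → X} (hg : g ∈ expSpan μ X) (hh : h ∈ expSpan μ X) :
    (fun t => g t + h t) ∈ expSpan μ X := add_mem hg hh

theorem fun_smul_mem_expSpan (a : ℂ) {g : ℝ → X} (hg : g ∈ expSpan μ X) :
    (fun t => a • g t) ∈ expSpan μ X := Submodule.smul_mem _ a hg

theorem map_mem_expSpan (L : X →ₗ[ℂ] Y) {g : ℝ → X} (hg : g ∈ expSpan μ X) :
    (fun t => L (g t)) ∈ expSpan μ Y := by
  induction hg using Submodule.span_induction with
  | mem g hg =>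
    obtain ⟨z, i, x, hz, rfl⟩ := hg
    simpa using monomial_mem_expSpan z hz i (L x)
  | zero => simpa using fun_zero_mem_expSpan
  | add g h _ _ hg hh => simpa using fun_add_mem_expSpan hg hh
  | smul a g _ hg => simpa using fun_smul_mem_expSpan a hg

theorem smul_const_mem_expSpan {g : ℝ → ℂ} (hg : g ∈ expSpan μ ℂ) (x : X) :
    (fun t => g t • x) ∈ expSpan μ X :=
  map_mem_expSpan (LinearMap.toSpanSingleton ℂ X x) hg

theorem mul_mem_expSpan {g h : ℝ → ℂ} (hg : g ∈ expSpan μ ℂ) (hh : h ∈ expSpan ν ℂ) :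
    (fun t => g t * h t) ∈ expSpan (μ + ν) ℂ := by
  induction hg using Submodule.span_induction with
  | mem g hg =>
    obtain ⟨z, i, x, hz, rfl⟩ := hg
    induction hh using Submodule.span_induction with
    | mem h hh =>
      obtain ⟨w, j, y, hw, rfl⟩ := hh
      convert monomial_mem_expSpan (z + w) (by simp [hz, hw] : (z + w).re = μ + ν) (i + j) (x * y)
        using 2 with t
      simp only [smul_eq_mul, add_mul, Complex.exp_add, pow_add]
      ring
    | zero => simpa using fun_zero_mem_expSpan
    | add g h _ _ hg hh => simpa [mul_add] using fun_add_mem_expSpan hg hh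
    | smul a g _ hg => simpa [mul_left_comm] using fun_smul_mem_expSpan a hg
  | zero => simpa using fun_zero_mem_expSpan
  | add g h _ _ hg hh => simpa [add_mul] using fun_add_mem_expSpan hg hh
  | smul a g _ hg => simpa [mul_assoc] using fun_smul_mem_expSpan a hg

theorem one_mem_expSpan : (fun _ => (1 : ℂ)) ∈ expSpan 0 ℂ := by
  simpa using monomial_mem_expSpan (0 : ℂ) (by simp) 0 (1 : ℂ)

theorem prod_mem_expSpan {ι : Type*} (s : Finset ι) (γ : ι → ℝ) (g : ι → ℝ → ℂ)
    (hg : ∀ i ∈ s, g i ∈ expSpan (γ i) ℂ) :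
    (fun t => ∏ i ∈ s, g i t) ∈ expSpan (∑ i ∈ s, γ i) ℂ := by
  classical
  induction s using Finset.induction_on with
  | empty => simpa using one_mem_expSpan
  | insert a s ha ih =>
    simp only [Finset.prod_insert ha, Finset.sum_insert ha]
    exact mul_mem_expSpan (hg a (by simp)) (ih fun i hi => hg i (by simp [hi]))

theorem conj_mem_expSpan {g : ℝ → ℂ} (hg : g ∈ expSpan μ ℂ) :
    (fun t => (starRingEnd ℂ) (g t)) ∈ expSpan μ ℂ := by
  induction hg using Submodule.span_induction with
  | mem g hg =>
    obtain ⟨z, i, x, hz, rfl⟩ := hg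
    convert monomial_mem_expSpan ((starRingEnd ℂ) z) (by simpa using hz) i ((starRingEnd ℂ) x)
      using 2 with t
    simp [← Complex.exp_conj]
  | zero => simpa using fun_zero_mem_expSpan
  | add g h _ _ hg hh => simpa using fun_add_mem_expSpan hg hh
  | smul a g _ hg => simpa using fun_smul_mem_expSpan ((starRingEnd ℂ) a) hg

/-- Conjugation replaces a frequency `z` by its conjugate, which has the same real part. This is
what allows a complex solution to be replaced by its real part later. -/
theorem re_mem_expSpan {g : ℝ → ℂ} (hg : g ∈ expSpan μ ℂ) :
    (fun t => ((g t).re : ℂ)) ∈ expSpan μ ℂ := by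
  convert (expSpan μ ℂ).smul_mem (1 / 2) ((expSpan μ ℂ).add_mem hg (conj_mem_expSpan hg)) using 1
  ext t
  simp only [Pi.smul_apply, Pi.add_apply, Complex.add_conj, smul_eq_mul]
  push_cast
  ring

theorem mem_expSpan_euclidean_iff {n : ℕ} {g : ℝ → EuclideanSpace ℂ (Fin n)} :
    g ∈ expSpan μ (EuclideanSpace ℂ (Fin n)) ↔ ∀ i, (fun t => g t i) ∈ expSpan μ ℂ := by
  constructor
  · intro h i
    exact map_mem_expSpan (EuclideanSpace.proj (𝕜 := ℂ) i).toLinearMap h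
  · intro h
    have : g = ∑ i, fun t => g t i • EuclideanSpace.single i (1 : ℂ) := by
      ext t j
      simp [Finset.sum_apply, Pi.single_apply]
    rw [this]
    exact Submodule.sum_mem _ fun i _ => smul_const_mem_expSpan (h i) _

/-- The equation `z' + c z = g` with an exponential polynomial `g` has an exponential polynomial
solution of the same exponential rate. -/
theorem exists_expSpan_hasDerivAt (c : ℂ) {g : ℝ → ℂ} (hg : g ∈ expSpan μ ℂ) :
    ∃ z ∈ expSpan μ ℂ, ∀ t, HasDerivAt z (-(c * z t) + g t) t := by
  have hexp : ∀ (w : ℂ) (t : ℝ),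
      HasDerivAt (fun t : ℝ => Complex.exp (w * t)) (Complex.exp (w * t) * w) t := by
    intro w t
    have h := ((hasDerivAt_id (t : ℂ)).const_mul w).cexp.comp_ofReal
    simpa using h
  have hpow : ∀ (i : ℕ) (t : ℝ),
      HasDerivAt (fun t : ℝ => (t : ℂ) ^ (i + 1)) ((i + 1 : ℂ) * (t : ℂ) ^ i) t := by
    intro i t
    have h := (hasDerivAt_pow (i + 1) (t : ℂ)).comp_ofReal
    simpa using h
  induction hg using Submodule.span_induction with
  | mem g hg =>
    obtain ⟨w, i, x, hw, rfl⟩ := hg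
    -- In the resonant case `w = -c` the degree rises by one. Otherwise the degree is lowered by
    -- induction: the trial solution with `x / (w + c)` leaves an error of degree `i`, which is
    -- solved for and subtracted.
    by_cases hc : w + c = 0
    · refine ⟨fun t : ℝ => Complex.exp (w * t) • ((t : ℂ) ^ (i + 1) • (x / (i + 1))),
        monomial_mem_expSpan w hw _ _, fun t => ?_⟩
      refine ((hexp w t).mul ((hpow i t).mul_const (x / (i + 1)))).congr_deriv ?_
      have : (i + 1 : ℂ) ≠ 0 := by exact_mod_cast Nat.succ_ne_zero i
      have hc' : c = -w := by linear_combination hc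
      simp only [smul_eq_mul, hc']
      field_simp
    · induction i generalizing x with
      | zero =>
        refine ⟨_, monomial_mem_expSpan w hw 0 (x / (w + c)), fun t => ?_⟩
        simp only [pow_zero, smul_eq_mul, one_mul]
        refine ((hexp w t).mul_const (x / (w + c))).congr_deriv ?_
        field_simp
        ring
      | succ i ih =>
        obtain ⟨z, hz, hz'⟩ := ih ((i + 1) * x / (w + c))
        refine ⟨_, (expSpan μ ℂ).sub_mem (monomial_mem_expSpan w hw (i + 1) (x / (w + c))) hz,
          fun t => ?_⟩
        refine (((hexp w t).mul ((hpow i t).mul_const (x / (w + c)))).sub (hz' t)).congr_deriv ?_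
        simp only [smul_eq_mul, Pi.sub_apply]
        field_simp
        ring
  | zero => exact ⟨0, zero_mem _, fun t => by simp⟩
  | add g h _ _ hg hh =>
    obtain ⟨z, hz, hz'⟩ := hg
    obtain ⟨w, hw, hw'⟩ := hh
    refine ⟨z + w, add_mem hz hw, fun t => ?_⟩
    refine ((hz' t).add (hw' t)).congr_deriv ?_
    simp only [Pi.add_apply]
    ring
  | smul a g _ hg =>
    obtain ⟨z, hz, hz'⟩ := hg
    refine ⟨a • z, Submodule.smul_mem _ a hz, fun t => ?_⟩
    refine ((hz' t).const_smul a).congr_deriv ?_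
    simp only [Pi.smul_apply, smul_eq_mul]
    ring

end ExpSpan

theorem isBigO_exp_neg_of_le {μ ν : ℝ} (h : ν ≤ μ) :
    (fun t : ℝ => Real.exp (-μ * t)) =O[atTop] fun t => Real.exp (-ν * t) := by
  refine IsBigO.of_bound 1 ?_
  filter_upwards [eventually_ge_atTop 0] with t ht
  rw [Real.norm_of_nonneg (Real.exp_pos _).le, Real.norm_of_nonneg (Real.exp_pos _).le, one_mul]
  exact Real.exp_le_exp.2 (by nlinarith)

/-- The inequality `ν < μ` is strict because the polynomial factors must be absorbed by `exp ((μ -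
ν) t)`. This is why all rates below are chosen with some room. -/
theorem isBigO_of_mem_expSpan {X : Type*} [NormedAddCommGroup X] [NormedSpace ℂ X] {μ ν : ℝ}
    (hν : ν < μ) {g : ℝ → X} (hg : g ∈ expSpan (-μ) X) :
    g =O[atTop] fun t => Real.exp (-ν * t) := by
  induction hg using Submodule.span_induction with
  | mem g hg =>
    obtain ⟨z, i, x, hz, rfl⟩ := hg
    have h := (isLittleO_pow_exp_pos_mul_atTop i (sub_pos.2 hν)).isBigO
    have h2 := (isBigO_refl (fun t : ℝ => Real.exp (-μ * t)) atTop).mul h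
    refine (IsBigO.of_bound ‖x‖ (Eventually.of_forall fun t => ?_)).trans (h2.congr_right ?_)
    · rw [norm_smul, norm_smul, Complex.norm_exp, norm_mul, Real.norm_of_nonneg (Real.exp_pos _).le]
      simp only [Complex.mul_re, hz, Complex.ofReal_re, Complex.ofReal_im, mul_zero, sub_zero,
        norm_pow, Complex.norm_real]
      exact le_of_eq (by ring)
    · intro t
      rw [← Real.exp_add]
      ring_nf
  | zero => exact isBigO_zero _ _
  | add g h _ _ hg hh => exact hg.add hh
  | smul a g _ hg => exact hg.const_smul_left a

/-! ### Linear equations -/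

/-- Splitting off a left eigenvector `φ` of an endomorphism: the kernel `W` of `φ` is an invariant
hyperplane with complement spanned by `e`. -/
theorem exists_triangular_splitting {V : Type*} [AddCommGroup V] [Module ℂ V]
    [FiniteDimensional ℂ V] [Nontrivial V] (B : V →ₗ[ℂ] V) :
    ∃ (z : ℂ) (φ : V →ₗ[ℂ] ℂ) (e : V) (W : Submodule ℂ V) (P : V →ₗ[ℂ] W) (C : W →ₗ[ℂ] W),
      Module.End.HasEigenvalue B z ∧
      (∀ w, Module.End.HasEigenvalue C w → Module.End.HasEigenvalue B w) ∧
      Module.finrank ℂ W < Module.finrank ℂ V ∧ φ e = 1 ∧ (∀ x, φ (B x) = z * φ x) ∧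
      (∀ x, (P x : V) + φ x • e = x) ∧ (∀ x : W, B x = C x) ∧
      ∀ x, P (B x) = C (P x) + φ x • P (B e) := by
  obtain ⟨z, hz⟩ := Module.End.exists_eigenvalue B
  -- In finite dimension `B - z` is not injective, hence not surjective. A nonzero functional that
  -- vanishes on its range is a left eigenvector of `B`.
  have hlt : LinearMap.range (B - algebraMap ℂ (Module.End ℂ V) z) < ⊤ := by
    rw [lt_top_iff_ne_top, Ne, ← LinearMap.ker_eq_bot_iff_range_eq_top]
    have := hz
    rwa [Module.End.hasEigenvalue_iff, Module.End.eigenspace_def] at this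
  obtain ⟨ψ, hψ, hle⟩ := Submodule.exists_le_ker_of_lt_top _ hlt
  obtain ⟨v, hv⟩ : ∃ v, ψ v ≠ 0 := by
    by_contra! h
    exact hψ (LinearMap.ext h)
  set e := (ψ v)⁻¹ • v with he
  have h1 : ψ e = 1 := by simp [he, hv]
  have h2 : ∀ x, ψ (B x) = z * ψ x := fun x => by
    have : ψ ((B - algebraMap ℂ (Module.End ℂ V) z) x) = 0 := hle ⟨x, rfl⟩
    simpa [sub_eq_zero, Module.algebraMap_end_apply] using this
  let W := LinearMap.ker ψ
  let P : V →ₗ[ℂ] W := (LinearMap.id - LinearMap.smulRight ψ e).codRestrict W fun x => by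
    simp [W, h1]
  have hinv : ∀ x ∈ W, B x ∈ W := fun x hx => by
    have hx' : ψ x = 0 := hx
    simp [W, h2, hx']
  let C : W →ₗ[ℂ] W := B.restrict hinv
  have hP : ∀ x, (P x : V) = x - ψ x • e := fun x => rfl
  have hC : ∀ x : W, B x = C x := fun x => rfl
  have hPW : ∀ x : W, P x = x := fun x => Subtype.ext <| by
    rw [hP, LinearMap.mem_ker.1 x.2, zero_smul, sub_zero]
  refine ⟨z, ψ, e, W, P, C, hz, fun w hw => ?_, ?_, h1, h2, fun x => by rw [hP]; abel, hC,
    fun x => ?_⟩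
  · obtain ⟨x, hx⟩ := hw.exists_hasEigenvector
    refine Module.End.hasEigenvalue_of_hasEigenvector (x := (x : V)) ⟨?_, ?_⟩
    · rw [Module.End.mem_eigenspace_iff, hC, hx.apply_eq_smul]
      rfl
    · exact fun h => hx.2 (Subtype.ext h)
  · refine Submodule.finrank_lt fun h => hψ (LinearMap.ker_eq_top.1 h)
  · have : x = (P x : V) + ψ x • e := by rw [hP]; abel
    conv_lhs => rw [this, map_add, map_add, map_smul, map_smul, hC, hPW]

theorem hasDerivAt_exp_mul (κ t : ℝ) :
    HasDerivAt (fun t => Real.exp (κ * t)) (κ * Real.exp (κ * t)) t := by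
  simpa [mul_comm] using ((hasDerivAt_id t).const_mul κ).exp

/-- A function whose derivative is bounded by a multiple of `exp (κ t)`. -/
theorem norm_sub_le_of_deriv_le_exp {E : Type*} [NormedAddCommGroup E] [NormedSpace ℝ E]
    {p p' : ℝ → E} {s t M κ : ℝ} (hκ : κ ≠ 0) (hst : s ≤ t)
    (hp : ∀ τ ∈ Icc s t, HasDerivAt p (p' τ) τ)
    (hb : ∀ τ ∈ Icc s t, ‖p' τ‖ ≤ M * Real.exp (κ * τ)) :
    ‖p t - p s‖ ≤ M / κ * (Real.exp (κ * t) - Real.exp (κ * s)) := by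
  refine image_norm_le_of_norm_deriv_right_le_deriv_boundary' (f := fun τ => p τ - p s) (f' := p')
    (B := fun τ => M / κ * (Real.exp (κ * τ) - Real.exp (κ * s)))
    (B' := fun τ => M * Real.exp (κ * τ)) (a := s) (b := t) ?_ ?_ ?_ ?_ ?_ ?_ ⟨hst, le_rfl⟩
  · exact fun τ hτ => ((hp τ hτ).sub_const _).continuousAt.continuousWithinAt
  · exact fun τ hτ => ((hp τ ⟨hτ.1, hτ.2.le⟩).sub_const _).hasDerivWithinAt
  · simp
  · exact Continuous.continuousOn (by fun_prop)
  · intro τ _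
    refine HasDerivAt.hasDerivWithinAt ?_
    refine (((hasDerivAt_exp_mul κ τ).sub_const _).const_mul (M / κ)).congr_deriv ?_
    field_simp
  · exact fun τ hτ => hb τ ⟨hτ.1, hτ.2.le⟩

/-- For `κ < 0` the bound on the derivative is integrable at infinity, so `p` is Cauchy; the
integral over the tail bounds the distance to the limit. -/
theorem exists_forall_norm_sub_le_of_deriv_le_exp {E : Type*} [NormedAddCommGroup E]
    [NormedSpace ℝ E] [CompleteSpace E] {p p' : ℝ → E} {T M κ : ℝ} (hκ : κ < 0)
    (hp : ∀ τ, T ≤ τ → HasDerivAt p (p' τ) τ)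
    (hb : ∀ τ, T ≤ τ → ‖p' τ‖ ≤ M * Real.exp (κ * τ)) :
    ∃ L, Tendsto p atTop (𝓝 L) ∧ ∀ s, T ≤ s → ‖p s - L‖ ≤ M / -κ * Real.exp (κ * s) := by
  have hM : 0 ≤ M := by
    have := (norm_nonneg _).trans (hb T le_rfl)
    exact nonneg_of_mul_nonneg_left this (Real.exp_pos _)
  have hbd : ∀ s t, T ≤ s → s ≤ t → ‖p t - p s‖ ≤ M / -κ * Real.exp (κ * s) := by
    intro s t hs hst
    have h := norm_sub_le_of_deriv_le_exp hκ.ne hst (fun τ hτ => hp τ (hs.trans hτ.1))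
      (fun τ hτ => hb τ (hs.trans hτ.1))
    have h2 : 0 ≤ M / -κ * Real.exp (κ * t) :=
      mul_nonneg (div_nonneg hM (by linarith)) (Real.exp_pos _).le
    have h3 : M / κ * (Real.exp (κ * t) - Real.exp (κ * s)) =
      M / -κ * Real.exp (κ * s) - M / -κ * Real.exp (κ * t) := by rw [div_neg]; ring
    linarith
  have htend : Tendsto (fun s : ℝ => M / -κ * Real.exp (κ * s)) atTop (𝓝 0) := by
    have h : Tendsto (fun s : ℝ => κ * s) atTop atBot :=
      tendsto_id.const_mul_atTop_of_neg hκ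
    simpa using (Real.tendsto_exp_atBot.comp h).const_mul (M / -κ)
  have hc : CauchySeq fun s => p (max s T) := by
    refine Metric.cauchySeq_iff'.2 fun ε hε => ?_
    obtain ⟨N, hN, hT⟩ := ((htend.eventually_lt_const hε).and (eventually_ge_atTop T)).exists
    refine ⟨N, fun t ht => ?_⟩
    rw [dist_eq_norm, max_eq_left hT, max_eq_left (hT.trans ht)]
    exact (hbd N t hT ht).trans_lt hN
  obtain ⟨L, hL⟩ := cauchySeq_tendsto_of_complete hc
  have hL' : Tendsto p atTop (𝓝 L) := by
    refine hL.congr' ?_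
    filter_upwards [eventually_ge_atTop T] with t ht
    rw [max_eq_left ht]
  refine ⟨L, hL', fun s hs => ?_⟩
  refine le_of_tendsto (f := fun t => ‖p s - p t‖) (tendsto_const_nhds.sub hL').norm ?_
  filter_upwards [eventually_ge_atTop s] with t ht
  rw [norm_sub_rev]
  exact hbd s t hs ht

theorem hasDerivAt_integrating_factor {z : ℂ} {u : ℝ → ℂ} {h : ℂ} {t : ℝ}
    (hu : HasDerivAt u (-(z * u t) + h) t) :
    HasDerivAt (fun t : ℝ => Complex.exp (z * t) * u t) (Complex.exp (z * t) * h) t := by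
  have h1 : HasDerivAt (fun t : ℝ => Complex.exp (z * t)) (Complex.exp (z * t) * z) t := by
    simpa using ((hasDerivAt_id (t : ℂ)).const_mul z).cexp.comp_ofReal
  refine (h1.mul hu).congr_deriv ?_
  ring

theorem norm_cexp_mul_ofReal (z : ℂ) (t : ℝ) : ‖Complex.exp (z * t)‖ = Real.exp (z.re * t) := by
  simp [Complex.norm_exp]

theorem isBigO_cexp_mul (z : ℂ) :
    (fun t : ℝ => Complex.exp (z * t)) =O[atTop] fun t => Real.exp (z.re * t) :=
  IsBigO.of_bound 1 (Eventually.of_forall fun t => by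
    rw [norm_cexp_mul_ofReal, Real.norm_of_nonneg (Real.exp_pos _).le, one_mul])

/-- Multiplication by `exp (z t)` removes the linear term, and the forcing is then integrated. The
constant depends only on `a - b`, which makes it uniform in the solution and in the interval. -/
theorem scalar_exp_bound {z : ℂ} {a b : ℝ} (hba : b < a) (ha : a ≤ z.re) {t₀ t₁ M : ℝ} (hM : 0 ≤ M)
    {u h : ℝ → ℂ} (hu : ∀ t ∈ Icc t₀ t₁, HasDerivAt u (-(z * u t) + h t) t)
    (hh : ∀ t ∈ Icc t₀ t₁, ‖h t‖ ≤ M * Real.exp (-b * (t - t₀))) {t : ℝ} (ht : t ∈ Icc t₀ t₁) :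
    ‖u t‖ ≤ (1 + 1 / (a - b)) * (‖u t₀‖ + M) * Real.exp (-b * (t - t₀)) := by
  have hκ : 0 < z.re - b := by linarith
  have key := norm_sub_le_of_deriv_le_exp (M := M * Real.exp (b * t₀)) hκ.ne' ht.1
    (fun τ hτ => hasDerivAt_integrating_factor (hu τ ⟨hτ.1, hτ.2.trans ht.2⟩)) (fun τ hτ => by
      rw [norm_mul, norm_cexp_mul_ofReal]
      calc _ ≤ Real.exp (z.re * τ) * (M * Real.exp (-b * (τ - t₀))) := by
            gcongr
            exact hh τ ⟨hτ.1, hτ.2.trans ht.2⟩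
        _ = M * (Real.exp (z.re * τ) * Real.exp (-b * (τ - t₀))) := by ring
        _ = M * (Real.exp (b * t₀) * Real.exp ((z.re - b) * τ)) := by
            rw [← Real.exp_add, ← Real.exp_add]; ring_nf
        _ = _ := by ring)
  have h1 : Real.exp (z.re * t) * ‖u t‖ ≤ Real.exp (z.re * t₀) * ‖u t₀‖ +
      M * Real.exp (b * t₀) / (z.re - b) * Real.exp ((z.re - b) * t) := by
    have h2 := norm_sub_norm_le (Complex.exp (z * t) * u t) (Complex.exp (z * t₀) * u t₀)
    rw [norm_mul, norm_mul, norm_cexp_mul_ofReal, norm_cexp_mul_ofReal] at h2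
    have h3 : 0 ≤ M * Real.exp (b * t₀) / (z.re - b) * Real.exp ((z.re - b) * t₀) := by positivity
    linarith
  have h4 : ‖u t‖ ≤ Real.exp (-z.re * (t - t₀)) * ‖u t₀‖ +
      M / (z.re - b) * Real.exp (-b * (t - t₀)) := by
    have e1 : Real.exp (-z.re * t) * Real.exp (z.re * t) = 1 := by
      rw [← Real.exp_add]; simp
    have e2 : Real.exp (-z.re * t) * Real.exp (z.re * t₀) = Real.exp (-z.re * (t - t₀)) := by
      rw [← Real.exp_add]; ring_nf
    have e3 : Real.exp (-z.re * t) * (Real.exp (b * t₀) * Real.exp ((z.re - b) * t)) =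
        Real.exp (-b * (t - t₀)) := by
      rw [← Real.exp_add, ← Real.exp_add]; ring_nf
    have := mul_le_mul_of_nonneg_left h1 (Real.exp_pos (-z.re * t)).le
    calc ‖u t‖ = Real.exp (-z.re * t) * (Real.exp (z.re * t) * ‖u t‖) := by
          rw [← mul_assoc, e1, one_mul]
      _ ≤ _ := this
      _ = (Real.exp (-z.re * t) * Real.exp (z.re * t₀)) * ‖u t₀‖ + M / (z.re - b) *
          (Real.exp (-z.re * t) * (Real.exp (b * t₀) * Real.exp ((z.re - b) * t))) := by ring
      _ = _ := by rw [e2, e3]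
  have h5 : Real.exp (-z.re * (t - t₀)) ≤ Real.exp (-b * (t - t₀)) :=
    Real.exp_le_exp.2 (by nlinarith [ht.1])
  have h6 : M / (z.re - b) ≤ 1 / (a - b) * M := by
    rw [div_eq_mul_one_div, mul_comm]
    exact mul_le_mul_of_nonneg_right
      (one_div_le_one_div_of_le (by linarith) (by linarith)) hM
  have h7 : 0 ≤ 1 / (a - b) := by
    have : 0 < a - b := by linarith
    positivity
  have h8 := Real.exp_pos (-b * (t - t₀))
  calc ‖u t‖ ≤ _ := h4
    _ ≤ Real.exp (-b * (t - t₀)) * ‖u t₀‖ + 1 / (a - b) * M * Real.exp (-b * (t - t₀)) := by gcongr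
    _ = (‖u t₀‖ + 1 / (a - b) * M) * Real.exp (-b * (t - t₀)) := by ring
    _ ≤ _ := by
      gcongr
      nlinarith [norm_nonneg (u t₀)]

theorem LinearMap.exists_norm_le {V W : Type*} [NormedAddCommGroup V] [NormedSpace ℂ V]
    [NormedAddCommGroup W] [NormedSpace ℂ W] [FiniteDimensional ℂ V] (L : V →ₗ[ℂ] W) :
    ∃ K, 0 ≤ K ∧ ∀ x, ‖L x‖ ≤ K * ‖x‖ :=
  ⟨_, norm_nonneg _, L.toContinuousLinearMap.le_opNorm⟩

theorem LinearMap.hasDerivAt_comp {V W : Type*} [NormedAddCommGroup V] [NormedSpace ℂ V]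
    [NormedAddCommGroup W] [NormedSpace ℂ W] [FiniteDimensional ℂ V] (L : V →ₗ[ℂ] W)
    {w : ℝ → V} {w' : V} {t : ℝ} (hw : HasDerivAt w w' t) :
    HasDerivAt (fun t => L (w t)) (L w') t :=
  (L.toContinuousLinearMap.restrictScalars ℝ).hasFDerivAt.comp_hasDerivAt t hw

universe u

/-- Exponential bound for `w' + B w = h`, with rate below the real parts of the eigenvalues. -/
theorem exists_exp_bound {a b : ℝ} (hba : b < a) (d : ℕ) : ∀ (V : Type u) [NormedAddCommGroup V]
    [NormedSpace ℂ V] [FiniteDimensional ℂ V] (B : V →ₗ[ℂ] V), Module.finrank ℂ V = d →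
    (∀ z, Module.End.HasEigenvalue B z → a ≤ z.re) →
    ∃ K, 0 ≤ K ∧ ∀ (t₀ t₁ M : ℝ) (w h : ℝ → V), 0 ≤ M →
      (∀ t ∈ Icc t₀ t₁, HasDerivAt w (-(B (w t)) + h t) t) →
      (∀ t ∈ Icc t₀ t₁, ‖h t‖ ≤ M * Real.exp (-b * (t - t₀))) →
      ∀ t ∈ Icc t₀ t₁, ‖w t‖ ≤ K * (‖w t₀‖ + M) * Real.exp (-b * (t - t₀)) := by
  induction d using Nat.strong_induction_on with
  | _ d ih =>
  intro V _ _ _ B hd hB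
  rcases subsingleton_or_nontrivial V with hV | hV
  · refine ⟨0, le_rfl, fun t₀ t₁ M w h _ _ _ t _ => ?_⟩
    rw [Subsingleton.elim (w t) 0]
    simp
  obtain ⟨z, φ, e, W, P, C, hz, hC, hrank, he, hφ, hdec, hBC, hP⟩ := exists_triangular_splitting B
  obtain ⟨K, hK, hW⟩ := ih _ (hd ▸ hrank) W C rfl fun w hw => hB w (hC w hw)
  obtain ⟨Kφ, hKφ, hφb⟩ := φ.exists_norm_le
  obtain ⟨KP, hKP, hPb⟩ := P.exists_norm_le
  set v := P (B e) with hv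
  have hab : 0 < a - b := by linarith
  set K₁ := (1 + 1 / (a - b)) * Kφ with hK₁
  have hK₁0 : 0 ≤ K₁ := by positivity
  refine ⟨K * (KP + K₁ * ‖v‖) + K₁ * ‖e‖, by positivity, fun t₀ t₁ M w h hM hw hh t ht => ?_⟩
  set S := ‖w t₀‖ + M with hS
  have hS0 : 0 ≤ S := by positivity
  have hu : ∀ t ∈ Icc t₀ t₁, ‖φ (w t)‖ ≤ K₁ * S * Real.exp (-b * (t - t₀)) := by
    intro t ht
    refine (scalar_exp_bound hba (hB z hz) (M := Kφ * M) (by positivity)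
      (u := fun t => φ (w t)) (h := fun t => φ (h t)) (fun t ht => ?_) (fun t ht => ?_) ht).trans ?_
    · simpa [hφ] using φ.hasDerivAt_comp (hw t ht)
    · rw [mul_assoc]
      exact (hφb _).trans (mul_le_mul_of_nonneg_left (hh t ht) hKφ)
    · have h1 : ‖φ (w t₀)‖ + Kφ * M ≤ Kφ * S := by
        rw [hS, mul_add]
        exact add_le_add_left (hφb _) _
      rw [hK₁, mul_assoc _ Kφ S]
      gcongr
  -- The hyperplane component sees the scalar component, already bounded in `hu`, as an additional
  -- forcing `-φ(w) v`.
  have hPw := hW t₀ t₁ (KP * M + K₁ * S * ‖v‖) (fun t => P (w t))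
    (fun t => P (h t) - φ (w t) • v) (by positivity) (fun t ht => by
      refine (P.hasDerivAt_comp (hw t ht)).congr_deriv ?_
      rw [map_add, map_neg, hP]
      abel) (fun t ht => by
      refine (norm_sub_le _ _).trans ?_
      rw [norm_smul, add_mul]
      refine add_le_add ?_ ?_
      · rw [mul_assoc]
        exact (hPb _).trans (mul_le_mul_of_nonneg_left (hh t ht) hKP)
      · rw [mul_right_comm]
        exact mul_le_mul_of_nonneg_right (hu t ht) (norm_nonneg _)) t ht
  have hE := Real.exp_pos (-b * (t - t₀))
  calc ‖w t‖ = ‖(P (w t) : V) + φ (w t) • e‖ := by rw [hdec]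
    _ ≤ ‖P (w t)‖ + ‖φ (w t)‖ * ‖e‖ := by
      refine (norm_add_le _ _).trans_eq ?_
      rw [norm_smul]
      rfl
    _ ≤ K * (‖P (w t₀)‖ + (KP * M + K₁ * S * ‖v‖)) * Real.exp (-b * (t - t₀)) +
        K₁ * S * Real.exp (-b * (t - t₀)) * ‖e‖ := by
      gcongr
      exact hu t ht
    _ ≤ K * (KP * ‖w t₀‖ + (KP * M + K₁ * S * ‖v‖)) * Real.exp (-b * (t - t₀)) +
        K₁ * S * Real.exp (-b * (t - t₀)) * ‖e‖ := by
      gcongr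
      exact hPb _
    _ = _ := by rw [hS]; ring

theorem scalar_exp_asymptotics {z : ℂ} {μ ν η : ℝ} (hνμ : ν < μ) (hμη : μ < η)
    (hz : z.re < ν ∨ μ ≤ z.re) {u g h : ℝ → ℂ} (hg : g ∈ expSpan (-μ) ℂ)
    (hu : u =O[atTop] fun t => Real.exp (-ν * t)) (hh : h =O[atTop] fun t => Real.exp (-η * t))
    (hd : ∀ᶠ t in atTop, HasDerivAt u (-(z * u t) + g t + h t) t) :
    ∃ y ∈ expSpan (-μ) ℂ, (∀ t, HasDerivAt y (-(z * y t) + g t) t) ∧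
      ∃ ρ, μ < ρ ∧ (fun t => u t - y t) =O[atTop] fun t => Real.exp (-ρ * t) := by
  obtain ⟨y₀, hy₀, hy₀'⟩ := exists_expSpan_hasDerivAt z hg
  set q : ℝ → ℂ := fun t => u t - y₀ t with hq
  have hqd : ∀ᶠ t in atTop, HasDerivAt q (-(z * q t) + h t) t := by
    filter_upwards [hd] with t ht
    refine (ht.sub (hy₀' t)).congr_deriv ?_
    simp only [hq]
    ring
  have hqO : q =O[atTop] fun t => Real.exp (-ν * t) := hu.sub (isBigO_of_mem_expSpan hνμ hy₀)
  set p : ℝ → ℂ := fun t => Complex.exp (z * t) * q t with hp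
  have hqp : ∀ t, q t = Complex.exp (-z * t) * p t := fun t => by
    rw [hp]
    simp only
    rw [← mul_assoc, ← Complex.exp_add]
    simp
  -- the derivative of `p`
  have hpd : ∀ η', η' ≤ η → ∃ T M : ℝ, ∀ t, T ≤ t →
      HasDerivAt p (Complex.exp (z * t) * h t) t ∧
        ‖Complex.exp (z * t) * h t‖ ≤ M * Real.exp ((z.re - η') * t) := by
    intro η' hη'
    obtain ⟨M, hM⟩ := (hh.trans (isBigO_exp_neg_of_le hη')).bound
    obtain ⟨T, hT⟩ := eventually_atTop.1 (hqd.and hM)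
    refine ⟨T, M, fun t ht => ⟨hasDerivAt_integrating_factor (hT t ht).1, ?_⟩⟩
    have h2 := (hT t ht).2
    rw [Real.norm_of_nonneg (Real.exp_pos _).le] at h2
    rw [norm_mul, norm_cexp_mul_ofReal]
    calc _ ≤ Real.exp (z.re * t) * (M * Real.exp (-η' * t)) := by gcongr
      _ = M * (Real.exp (z.re * t) * Real.exp (-η' * t)) := by ring
      _ = _ := by rw [← Real.exp_add]; ring_nf
  -- If `Re z > μ`, the homogeneous mode is itself negligible and `y₀` is the answer. If `Re z ≤ μ <
  -- η`, then `p` has a limit `L`, and `exp (-z t) L` is the only possible correction to `y₀`.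
  rcases lt_or_ge μ z.re with hcase | hcase
  · obtain ⟨ρ, hρ1, hρ2⟩ := exists_between (lt_min hμη hcase)
    obtain ⟨T, M, hTM⟩ := hpd ρ (hρ2.le.trans (min_le_left _ _))
    have hκ : 0 < z.re - ρ := by linarith [min_le_right η z.re]
    have hM : 0 ≤ M := by
      have := (norm_nonneg _).trans (hTM T le_rfl).2
      exact nonneg_of_mul_nonneg_left this (Real.exp_pos _)
    refine ⟨y₀, hy₀, hy₀', ρ, hρ1, ?_⟩
    have hpO : p =O[atTop] fun t => Real.exp ((z.re - ρ) * t) := by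
      refine IsBigO.of_bound (‖p T‖ + M / (z.re - ρ)) ?_
      filter_upwards [eventually_ge_atTop T, eventually_ge_atTop 0] with t ht ht0
      have h1 := norm_sub_le_of_deriv_le_exp hκ.ne' ht (fun τ hτ => (hTM τ hτ.1).1)
        (fun τ hτ => (hTM τ hτ.1).2)
      have h2 := norm_sub_norm_le (p t) (p T)
      have h3 : 0 ≤ M / (z.re - ρ) * Real.exp ((z.re - ρ) * T) := by positivity
      have h4 : 1 ≤ Real.exp ((z.re - ρ) * t) := Real.one_le_exp (by positivity)
      rw [Real.norm_of_nonneg (Real.exp_pos _).le]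
      nlinarith [norm_nonneg (p T)]
    refine ((isBigO_cexp_mul (-z)).mul hpO).congr (fun t => (hqp t).symm) fun t => ?_
    rw [← Real.exp_add, Complex.neg_re]
    ring_nf
  · obtain ⟨T, M, hTM⟩ := hpd η le_rfl
    obtain ⟨L, hL, hLb⟩ := exists_forall_norm_sub_le_of_deriv_le_exp
      (by linarith : z.re - η < 0) (fun τ hτ => (hTM τ hτ).1) (fun τ hτ => (hTM τ hτ).2)
    have hmain : (fun t : ℝ => q t - Complex.exp (-z * t) * L) =O[atTop]
        fun t => Real.exp (-η * t) := by
      refine IsBigO.of_bound (M / -(z.re - η)) ?_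
      filter_upwards [eventually_ge_atTop T] with t ht
      rw [hqp, ← mul_sub, norm_mul, norm_cexp_mul_ofReal, Real.norm_of_nonneg (Real.exp_pos _).le]
      calc _ ≤ Real.exp ((-z).re * t) * (M / -(z.re - η) * Real.exp ((z.re - η) * t)) := by
            gcongr
            exact hLb t ht
        _ = M / -(z.re - η) * (Real.exp ((-z).re * t) * Real.exp ((z.re - η) * t)) := by ring
        _ = _ := by
            rw [← Real.exp_add]
            simp only [Complex.neg_re]
            ring_nf
    -- A mode slower than `exp (-ν t)` is excluded by the a priori decay, so `L = 0`. In the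
    -- remaining case `Re z = μ`, and the mode is part of the term being constructed.
    rcases hz with hz | hz
    · have hL0 : L = 0 := by
        refine tendsto_nhds_unique hL ?_
        have hpO : p =O[atTop] fun t => Real.exp ((z.re - ν) * t) := by
          refine ((isBigO_cexp_mul z).mul hqO).congr_right fun t => ?_
          rw [← Real.exp_add]
          ring_nf
        refine hpO.trans_tendsto (Real.tendsto_exp_atBot.comp ?_)
        exact tendsto_id.const_mul_atTop_of_neg (by linarith)
      exact ⟨y₀, hy₀, hy₀', η, hμη, by simpa [hL0] using hmain⟩
    · have hzμ : z.re = μ := le_antisymm hcase hz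
      have hLmem : (fun t : ℝ => Complex.exp (-z * t) * L) ∈ expSpan (-μ) ℂ := by
        simpa using monomial_mem_expSpan (-z) (by simp [hzμ] : (-z).re = -μ) 0 L
      refine ⟨_, fun_add_mem_expSpan hy₀ hLmem, fun t => ?_, η, hμη, ?_⟩
      · have h1 : HasDerivAt (fun t : ℝ => Complex.exp (-z * t))
            (Complex.exp (-z * t) * -z) t := by
          simpa using ((hasDerivAt_id (t : ℂ)).const_mul (-z)).cexp.comp_ofReal
        refine ((hy₀' t).add (h1.mul_const L)).congr_deriv ?_
        ring
      · refine hmain.congr_left fun t => ?_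
        rw [hq]
        ring

/-- A decaying solution of `w' + B w = g + h`, with `g` an exponential polynomial of rate `-μ` and
`h` of faster decay, agrees to order beyond `exp (-μ t)` with an exponential polynomial solution of
`y' + B y = g`, if `w` decays faster than all the modes of `B` of rate slower than `exp (-μ t)`. -/
theorem exists_exp_asymptotics {μ ν : ℝ} (hνμ : ν < μ) (d : ℕ) : ∀ (V : Type u)
    [NormedAddCommGroup V] [NormedSpace ℂ V] [FiniteDimensional ℂ V] (B : V →ₗ[ℂ] V) (η : ℝ)
    (w g h : ℝ → V), Module.finrank ℂ V = d → μ < η →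
    (∀ z, Module.End.HasEigenvalue B z → z.re < ν ∨ μ ≤ z.re) → g ∈ expSpan (-μ) V →
    (w =O[atTop] fun t => Real.exp (-ν * t)) → (h =O[atTop] fun t => Real.exp (-η * t)) →
    (∀ᶠ t in atTop, HasDerivAt w (-(B (w t)) + g t + h t) t) →
    ∃ y ∈ expSpan (-μ) V, (∀ t, HasDerivAt y (-(B (y t)) + g t) t) ∧
      ∃ ρ, μ < ρ ∧ (fun t => w t - y t) =O[atTop] fun t => Real.exp (-ρ * t) := by
  induction d using Nat.strong_induction_on with
  | _ d ih =>
  intro V _ _ _ B η w g h hdim hμη hB hg hw hh hd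
  rcases subsingleton_or_nontrivial V with hV | hV
  · refine ⟨0, zero_mem _, fun t => ?_, η, hμη, ?_⟩
    · rw [Subsingleton.elim (-(B ((0 : ℝ → V) t)) + g t) 0]
      exact hasDerivAt_const t (0 : V)
    · exact (isBigO_zero _ _).congr_left fun t => Subsingleton.elim _ _
  obtain ⟨z, φ, e, W, P, C, hz, hC, hrank, he, hφ, hdec, hBC, hP⟩ := exists_triangular_splitting B
  have hcomp : ∀ {Y : Type u} [NormedAddCommGroup Y] [NormedSpace ℂ Y] (L : V →ₗ[ℂ] Y) {k : ℝ → V}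
      {θ : ℝ}, (k =O[atTop] fun t => Real.exp (-θ * t)) →
      (fun t => L (k t)) =O[atTop] fun t => Real.exp (-θ * t) := fun L _ _ hk =>
    (L.toContinuousLinearMap.isBigO_comp _ _).trans hk
  have hφO : ∀ {k : ℝ → V} {θ : ℝ}, (k =O[atTop] fun t => Real.exp (-θ * t)) →
      (fun t => φ (k t)) =O[atTop] fun t => Real.exp (-θ * t) := fun hk =>
    (φ.toContinuousLinearMap.isBigO_comp _ _).trans hk
  obtain ⟨y₁, hy₁, hy₁', ρ₁, hρ₁, hO₁⟩ := scalar_exp_asymptotics hνμ hμη (hB z hz)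
    (map_mem_expSpan φ hg) (hφO hw) (hφO hh) (hd.mono fun t ht => by
      simpa [hφ] using φ.hasDerivAt_comp ht)
  set v := P (B e) with hv
  -- The coupling `-φ(w) v` is divided: `-y₁ v` joins the exponential polynomial, and `-(φ(w) - y₁)
  -- v` joins the fast remainder, whose rate becomes `min η ρ₁`.
  obtain ⟨y₂, hy₂, hy₂', ρ₂, hρ₂, hO₂⟩ := ih _ (hdim ▸ hrank) W C (min η ρ₁)
    (fun t => P (w t)) (fun t => P (g t) - y₁ t • v)
    (fun t => P (h t) - (φ (w t) - y₁ t) • v) rfl (lt_min hμη hρ₁) (fun w hw => hB w (hC w hw))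
    (sub_mem (map_mem_expSpan P hg) (smul_const_mem_expSpan hy₁ v)) (hcomp P hw)
    (((hcomp P hh).trans (isBigO_exp_neg_of_le (min_le_left _ _))).sub (by
      refine IsBigO.trans ?_ (hO₁.trans (isBigO_exp_neg_of_le (min_le_right _ _)))
      refine IsBigO.of_bound ‖v‖ (Eventually.of_forall fun t => ?_)
      rw [norm_smul, mul_comm]))
    (hd.mono fun t ht => by
      refine (P.hasDerivAt_comp ht).congr_deriv ?_
      rw [map_add, map_add, map_neg, hP, sub_smul]
      abel)
  refine ⟨fun t => (y₂ t : V) + y₁ t • e, ?_, fun t => ?_, min ρ₁ ρ₂, lt_min hρ₁ hρ₂, ?_⟩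
  · exact fun_add_mem_expSpan (map_mem_expSpan W.subtype hy₂) (smul_const_mem_expSpan hy₁ e)
  · refine ((W.subtype.hasDerivAt_comp (hy₂' t)).add ((hy₁' t).smul_const e)).congr_deriv ?_
    have h1 : B e = (v : V) + z • e := by
      rw [← hdec (B e), hφ, he, mul_one]
    simp only [map_add, map_sub, map_neg, map_smul, h1, Submodule.subtype_apply, hBC]
    conv_rhs => rw [← hdec (g t)]
    module
  · have : ∀ t, w t - ((y₂ t : V) + y₁ t • e) =
        ((P (w t) - y₂ t : W) : V) + (φ (w t) - y₁ t) • e := fun t => by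
      conv_lhs => rw [← hdec (w t)]
      push_cast
      module
    simp only [this]
    refine IsBigO.add ?_ ?_
    · exact (W.subtypeL.isBigO_comp _ _).trans (hO₂.trans (isBigO_exp_neg_of_le (min_le_right _ _)))
    · refine IsBigO.trans ?_ (hO₁.trans (isBigO_exp_neg_of_le (min_le_left _ _)))
      refine IsBigO.of_bound ‖e‖ (Eventually.of_forall fun t => ?_)
      rw [norm_smul, mul_comm]

/-! ### Real vectors and their complexification -/

section Complexification

variable {n : ℕ}

/-- The inclusion of `ℝⁿ` into `ℂⁿ` as a linear isometry. -/
noncomputable def toComplexVecₗᵢ (n : ℕ) :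
    EuclideanSpace ℝ (Fin n) →ₗᵢ[ℝ] EuclideanSpace ℂ (Fin n) where
  toFun := toComplexVec
  map_add' x y := by ext i; simp [toComplexVec]
  map_smul' a x := by ext i; simp [toComplexVec]
  norm_map' x := by simp [EuclideanSpace.norm_eq, toComplexVec]

/-- The real part of a complex vector. -/
noncomputable def reVec (n : ℕ) : EuclideanSpace ℂ (Fin n) →L[ℝ] EuclideanSpace ℝ (Fin n) :=
  LinearMap.toContinuousLinearMap
    { toFun := fun x => WithLp.toLp 2 fun i => (x i).re
      map_add' := fun x y => by ext i; simp
      map_smul' := fun a x => by ext i; simp }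

theorem reVec_apply (x : EuclideanSpace ℂ (Fin n)) (i : Fin n) : reVec n x i = (x i).re := rfl

theorem toComplexVec_apply (x : EuclideanSpace ℝ (Fin n)) (i : Fin n) :
    toComplexVec x i = (x i : ℂ) := rfl

theorem toComplexVecₗᵢ_apply (x : EuclideanSpace ℝ (Fin n)) :
    toComplexVecₗᵢ n x = toComplexVec x := rfl

theorem norm_toComplexVec (x : EuclideanSpace ℝ (Fin n)) : ‖toComplexVec x‖ = ‖x‖ :=
  (toComplexVecₗᵢ n).norm_map x

theorem reVec_toComplexVec (x : EuclideanSpace ℝ (Fin n)) : reVec n (toComplexVec x) = x := by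
  ext i
  simp [reVec_apply, toComplexVec_apply]

theorem hasDerivAt_toComplexVec {w : ℝ → EuclideanSpace ℝ (Fin n)} {w' : EuclideanSpace ℝ (Fin n)}
    {t : ℝ} (hw : HasDerivAt w w' t) :
    HasDerivAt (fun t => toComplexVec (w t)) (toComplexVec w') t :=
  (toComplexVecₗᵢ n).toContinuousLinearMap.hasFDerivAt.comp_hasDerivAt t hw

/-- The complexification of the linear map given by a real matrix. -/
noncomputable def complexLin (A : Matrix (Fin n) (Fin n) ℝ) :
    EuclideanSpace ℂ (Fin n) →ₗ[ℂ] EuclideanSpace ℂ (Fin n) :=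
  Matrix.toEuclideanLin (A.map (fun a : ℝ => (a : ℂ)))

theorem toComplexVec_toEuclideanLin (A : Matrix (Fin n) (Fin n) ℝ)
    (x : EuclideanSpace ℝ (Fin n)) :
    toComplexVec (Matrix.toEuclideanLin A x) = complexLin A (toComplexVec x) := by
  ext i
  simp [toComplexVec, complexLin, Matrix.toLpLin_apply, Matrix.mulVec, dotProduct]

theorem reVec_complexLin (A : Matrix (Fin n) (Fin n) ℝ) (x : EuclideanSpace ℂ (Fin n)) :
    reVec n (complexLin A x) = Matrix.toEuclideanLin A (reVec n x) := by
  ext i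
  simp [reVec_apply, complexLin, Matrix.toLpLin_apply, Matrix.mulVec, dotProduct]

theorem mem_complexSpectrum_of_hasEigenvalue {A : Matrix (Fin n) (Fin n) ℝ} {z : ℂ}
    (hz : Module.End.HasEigenvalue (complexLin A) z) : z ∈ complexSpectrum A := by
  have h := Module.End.hasEigenvalue_iff_mem_spectrum.1 hz
  rw [complexSpectrum, ← Matrix.spectrum_toLpLin (p := 2)]
  exact h

variable {μ : ℝ}

theorem mem_RealExpClass_iff {g : ℝ → EuclideanSpace ℝ (Fin n)} :
    g ∈ RealExpClass μ n ↔ ∀ i, (fun t => ((g t i : ℝ) : ℂ)) ∈ expSpan μ ℂ := by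
  rw [RealExpClass, mem_ofPred_eq, mem_ExpClass_iff, mem_expSpan_euclidean_iff]
  rfl

theorem add_mem_RealExpClass {g h : ℝ → EuclideanSpace ℝ (Fin n)} (hg : g ∈ RealExpClass μ n)
    (hh : h ∈ RealExpClass μ n) : (fun t => g t + h t) ∈ RealExpClass μ n := by
  rw [mem_RealExpClass_iff] at *
  intro i
  simpa using fun_add_mem_expSpan (hg i) (hh i)

theorem sum_mem_RealExpClass {ι : Type*} (s : Finset ι) (g : ι → ℝ → EuclideanSpace ℝ (Fin n))
    (hg : ∀ i ∈ s, g i ∈ RealExpClass μ n) : (fun t => ∑ i ∈ s, g i t) ∈ RealExpClass μ n := by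
  classical
  induction s using Finset.induction_on with
  | empty =>
    rw [mem_RealExpClass_iff]
    intro i
    simpa using fun_zero_mem_expSpan
  | insert a s ha ih =>
    simp only [Finset.sum_insert ha]
    exact add_mem_RealExpClass (hg a (by simp)) (ih fun i hi => hg i (by simp [hi]))

theorem reVec_mem_RealExpClass {g : ℝ → EuclideanSpace ℂ (Fin n)}
    (hg : g ∈ expSpan μ (EuclideanSpace ℂ (Fin n))) :
    (fun t => reVec n (g t)) ∈ RealExpClass μ n :=
  mem_RealExpClass_iff.2 fun i => re_mem_expSpan (mem_expSpan_euclidean_iff.1 hg i)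

theorem isBigO_of_mem_RealExpClass {ν : ℝ} (hν : ν < μ) {g : ℝ → EuclideanSpace ℝ (Fin n)}
    (hg : g ∈ RealExpClass (-μ) n) : g =O[atTop] fun t => Real.exp (-ν * t) := by
  have h := isBigO_of_mem_expSpan hν (mem_ExpClass_iff.1 hg)
  exact IsBigO.of_norm_left (h.norm_left.congr_left fun t => norm_toComplexVec _)

/-- Expansion in the standard basis reduces norm bounds and class membership of multilinear
expressions to products of scalar coordinates. -/
theorem MultilinearMap.eq_sum_prod_smul {m : ℕ}
    (T : MultilinearMap ℝ (fun _ : Fin m => EuclideanSpace ℝ (Fin n)) (EuclideanSpace ℝ (Fin n)))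
    (x : Fin m → EuclideanSpace ℝ (Fin n)) :
    T x = ∑ r : Fin m → Fin n, (∏ i, x i (r i)) • T fun i => EuclideanSpace.single (r i) 1 := by
  have h : x = fun i => ∑ j, x i j • EuclideanSpace.single j (1 : ℝ) := by
    ext i j
    simp [Pi.single_apply]
  conv_lhs => rw [h, T.map_sum]
  exact Finset.sum_congr rfl fun r _ => T.map_smul_univ _ _

theorem MultilinearMap.exists_norm_le {m : ℕ}
    (T : MultilinearMap ℝ (fun _ : Fin m => EuclideanSpace ℝ (Fin n)) (EuclideanSpace ℝ (Fin n))) :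
    ∃ K, 0 ≤ K ∧ ∀ x, ‖T x‖ ≤ K * ∏ i, ‖x i‖ := by
  refine ⟨∑ r : Fin m → Fin n, ‖T fun i => EuclideanSpace.single (r i) 1‖, by positivity,
    fun x => ?_⟩
  rw [T.eq_sum_prod_smul x, Finset.sum_mul]
  refine (norm_sum_le _ _).trans (Finset.sum_le_sum fun r _ => ?_)
  rw [norm_smul, mul_comm, norm_prod]
  gcongr with i
  exact PiLp.norm_apply_le (x i) (r i)

theorem multilinear_mem_RealExpClass {m : ℕ}
    (T : MultilinearMap ℝ (fun _ : Fin m => EuclideanSpace ℝ (Fin n)) (EuclideanSpace ℝ (Fin n)))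
    (γ : Fin m → ℝ) (g : Fin m → ℝ → EuclideanSpace ℝ (Fin n))
    (hg : ∀ i, g i ∈ RealExpClass (-γ i) n) :
    (fun t => T fun i => g i t) ∈ RealExpClass (-∑ i, γ i) n := by
  rw [funext fun t => T.eq_sum_prod_smul fun i => g i t]
  refine sum_mem_RealExpClass _ _ fun r _ => mem_RealExpClass_iff.2 fun j => ?_
  have h := prod_mem_expSpan Finset.univ (fun i => -γ i) (fun i t => ((g i t (r i) : ℝ) : ℂ))
    fun i _ => mem_RealExpClass_iff.1 (hg i) (r i)
  rw [Finset.sum_neg_distrib] at h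
  simpa [mul_comm] using fun_smul_mem_expSpan
    (((T fun i => EuclideanSpace.single (r i) 1) j : ℝ) : ℂ) h

end Complexification

/-! ### Decay and asymptotics for the real system -/

section RealSystem

variable {n : ℕ} {A : Matrix (Fin n) (Fin n) ℝ}

/-- The complexified problem is solved and the real part taken. As `A` and the data are real, the
real part solves the same equation, and taking it preserves the error bound. -/
theorem exists_real_exp_asymptotics {μ ν η : ℝ} (hνμ : ν < μ) (hμη : μ < η)
    (hA : ∀ z ∈ complexSpectrum A, z.re < ν ∨ μ ≤ z.re)
    {w g h : ℝ → EuclideanSpace ℝ (Fin n)} (hg : g ∈ RealExpClass (-μ) n)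
    (hw : w =O[atTop] fun t => Real.exp (-ν * t)) (hh : h =O[atTop] fun t => Real.exp (-η * t))
    (hd : ∀ᶠ t in atTop, HasDerivAt w (-(Matrix.toEuclideanLin A (w t)) + g t + h t) t) :
    ∃ y ∈ RealExpClass (-μ) n,
      (∀ t, HasDerivAt y (-(Matrix.toEuclideanLin A (y t)) + g t) t) ∧
      ∃ ρ, μ < ρ ∧ (fun t => w t - y t) =O[atTop] fun t => Real.exp (-ρ * t) := by
  have hO : ∀ {k : ℝ → EuclideanSpace ℝ (Fin n)} {θ : ℝ},
      (k =O[atTop] fun t => Real.exp (-θ * t)) →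
      (fun t => toComplexVec (k t)) =O[atTop] fun t => Real.exp (-θ * t) := fun hk =>
    IsBigO.of_norm_left (hk.norm_left.congr_left fun t => (norm_toComplexVec _).symm)
  obtain ⟨y, hy, hy', ρ, hρ, hyO⟩ := exists_exp_asymptotics hνμ _ (EuclideanSpace ℂ (Fin n))
    (complexLin A) η (fun t => toComplexVec (w t)) (fun t => toComplexVec (g t))
    (fun t => toComplexVec (h t)) rfl hμη
    (fun z hz => hA z (mem_complexSpectrum_of_hasEigenvalue hz))
    (mem_ExpClass_iff.1 hg) (hO hw) (hO hh) (hd.mono fun t ht => by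
      refine (hasDerivAt_toComplexVec ht).congr_deriv ?_
      rw [← toComplexVec_toEuclideanLin]
      simp only [← toComplexVecₗᵢ_apply, map_add, map_neg])
  refine ⟨fun t => reVec n (y t), reVec_mem_RealExpClass hy, fun t => ?_, ρ, hρ, ?_⟩
  · refine ((reVec n).hasFDerivAt.comp_hasDerivAt t (hy' t)).congr_deriv ?_
    rw [map_add, map_neg, reVec_complexLin, reVec_toComplexVec]
  · refine (((reVec n).isBigO_comp _ _).trans hyO).congr_left fun t => ?_
    rw [map_sub, reVec_toComplexVec]

/-- A decaying solution of a perturbation of `y' = - A y` by superlinear terms and an exponentially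
decaying forcing decays exponentially, at any rate below the real parts of the eigenvalues. -/
theorem isBigO_exp_of_tendsto_zero {a b : ℝ} (hba : b < a)
    (hA : ∀ z ∈ complexSpectrum A, a ≤ z.re)
    {G : EuclideanSpace ℝ (Fin n) → EuclideanSpace ℝ (Fin n)}
    (hG : ∀ ε > 0, ∀ᶠ x in 𝓝 0, ‖G x‖ ≤ ε * ‖x‖) {f y : ℝ → EuclideanSpace ℝ (Fin n)}
    (hf : f =O[atTop] fun t => Real.exp (-b * t)) (hy : Tendsto y atTop (𝓝 0))
    (hd : ∀ᶠ t in atTop,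
      HasDerivAt y (-(Matrix.toEuclideanLin A (y t)) + G (y t) + f t) t) :
    y =O[atTop] fun t => Real.exp (-b * t) := by
  obtain ⟨K, hK, hbound⟩ := exists_exp_bound hba _ (EuclideanSpace ℂ (Fin n)) (complexLin A) rfl
    fun z hz => hA z (mem_complexSpectrum_of_hasEigenvalue hz)
  obtain ⟨F, hF⟩ := hf.bound
  -- Chosen so that `K ε ≤ 1/2`; the nonlinear contribution can then be absorbed on the left.
  set ε := 1 / (2 * (K + 1)) with hε
  have hε0 : 0 < ε := by positivity
  have hKε : K * ε ≤ 1 / 2 := by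
    rw [hε, mul_one_div, div_le_div_iff₀ (by positivity) (by positivity)]
    linarith
  obtain ⟨T, hT⟩ := eventually_atTop.1 (hd.and (hF.and (hy.eventually (hG ε hε0))))
  set F' := F * Real.exp (-b * T) with hF'
  have hF'0 : 0 ≤ F' := by
    have := (norm_nonneg _).trans (hT T le_rfl).2.1
    rwa [Real.norm_of_nonneg (Real.exp_pos _).le] at this
  have hfb : ∀ t, T ≤ t → ‖f t‖ ≤ F' * Real.exp (-b * (t - T)) := fun t ht => by
    have := (hT t ht).2.1
    rw [Real.norm_of_nonneg (Real.exp_pos _).le] at this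
    rw [hF', mul_assoc, ← Real.exp_add]
    refine this.trans_eq ?_
    ring_nf
  have hexp : ∀ t, Real.exp (-b * (t - T)) * Real.exp (b * (t - T)) = 1 := fun t => by
    rw [← Real.exp_add]
    simp
  have hfinal : ∀ t, T ≤ t → ‖y t‖ ≤ 2 * (K * (‖y T‖ + F')) * Real.exp (-b * (t - T)) := by
    intro t₁ ht₁
    have hcont : ContinuousOn (fun t => ‖y t‖ * Real.exp (b * (t - T))) (Icc T t₁) := by
      refine ContinuousOn.mul (ContinuousOn.norm fun t ht => ?_) (by fun_prop)
      exact (hT t ht.1).1.continuousAt.continuousWithinAt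
    -- The weighted maximum `S` on `[T, t₁]` is finite and satisfies `S ≤ K (‖y T‖ + ε S + F')`.
    -- Absorbing `K ε S` bounds `S` independently of `t₁`.
    obtain ⟨s, hs, hmax⟩ := isCompact_Icc.exists_isMaxOn (nonempty_Icc.2 ht₁) hcont
    set S := ‖y s‖ * Real.exp (b * (s - T)) with hS
    have hS0 : 0 ≤ S := by positivity
    have hyS : ∀ t ∈ Icc T t₁, ‖y t‖ ≤ S * Real.exp (-b * (t - T)) := by
      intro t ht
      have h1 : ‖y t‖ * Real.exp (b * (t - T)) ≤ S := hmax ht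
      calc ‖y t‖ = ‖y t‖ * Real.exp (b * (t - T)) * Real.exp (-b * (t - T)) := by
            rw [mul_assoc, mul_comm (Real.exp _), hexp, mul_one]
        _ ≤ _ := by gcongr
    have key := hbound T t₁ (ε * S + F') (fun t => toComplexVec (y t))
      (fun t => toComplexVec (G (y t) + f t)) (by positivity) (fun t ht => by
        refine (hasDerivAt_toComplexVec (hT t ht.1).1).congr_deriv ?_
        rw [← toComplexVec_toEuclideanLin]
        simp only [← toComplexVecₗᵢ_apply, map_add, map_neg]
        abel) (fun t ht => by
        rw [norm_toComplexVec, add_mul]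
        refine (norm_add_le _ _).trans (add_le_add ?_ (hfb t ht.1))
        refine (hT t ht.1).2.2.trans ?_
        rw [mul_assoc]
        exact mul_le_mul_of_nonneg_left (hyS t ht) hε0.le) s hs
    rw [norm_toComplexVec, norm_toComplexVec] at key
    have h2 : S ≤ K * (‖y T‖ + (ε * S + F')) := by
      calc S ≤ K * (‖y T‖ + (ε * S + F')) * Real.exp (-b * (s - T)) * Real.exp (b * (s - T)) := by
            rw [hS]
            gcongr
        _ = _ := by rw [mul_assoc, hexp, mul_one]
    have h3 : S ≤ 2 * (K * (‖y T‖ + F')) := by nlinarith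
    exact (hyS t₁ ⟨ht₁, le_rfl⟩).trans (by gcongr)
  refine IsBigO.of_bound (2 * (K * (‖y T‖ + F')) * Real.exp (b * T)) ?_
  filter_upwards [eventually_ge_atTop T] with t ht
  refine (hfinal t ht).trans_eq ?_
  rw [Real.norm_of_nonneg (Real.exp_pos _).le, mul_assoc _ (Real.exp _), ← Real.exp_add]
  ring_nf

/-- Changing the arguments one by one leaves one factor `y - s` and `m - 1 ≥ 1` factors of size `exp
(-b t)`; a single one of these supplies the gain `b`. -/
theorem multilinear_diag_sub_isBigO {m : ℕ} (hm : 2 ≤ m)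
    (T : MultilinearMap ℝ (fun _ : Fin m => EuclideanSpace ℝ (Fin n)) (EuclideanSpace ℝ (Fin n)))
    {b ν : ℝ} (hb : 0 ≤ b) {y s : ℝ → EuclideanSpace ℝ (Fin n)}
    (hy : y =O[atTop] fun t => Real.exp (-b * t)) (hs : s =O[atTop] fun t => Real.exp (-b * t))
    (hys : (fun t => y t - s t) =O[atTop] fun t => Real.exp (-ν * t)) :
    (fun t => (T fun _ => y t) - T fun _ => s t) =O[atTop] fun t => Real.exp (-(ν + b) * t) := by
  obtain ⟨K, hK, hT⟩ := T.exists_norm_le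
  have h1 : (fun t => (‖y t‖ + ‖s t‖) ^ (m - 1)) =O[atTop] fun t => Real.exp (-b * t) := by
    refine ((hy.norm_left.add hs.norm_left).pow (m - 1)).trans ?_
    refine IsBigO.trans ?_ (isBigO_exp_neg_of_le (μ := (m - 1 : ℕ) * b) ?_)
    · refine (isBigO_refl _ _).congr_left fun t => ?_
      rw [← Real.exp_nat_mul]
      ring_nf
    · have : (1 : ℝ) ≤ (m - 1 : ℕ) := by exact_mod_cast (by omega : 1 ≤ m - 1)
      nlinarith
  have h2 : (fun t => (‖y t‖ + ‖s t‖) ^ (m - 1) * ‖y t - s t‖) =O[atTop]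
      fun t => Real.exp (-(ν + b) * t) := by
    refine (h1.mul hys.norm_left).congr_right fun t => ?_
    rw [← Real.exp_add]
    ring_nf
  refine (IsBigO.of_bound (K * m) (Eventually.of_forall fun t => ?_)).trans h2
  have h3 := T.norm_image_sub_le_of_bound hK hT (fun _ => y t) (fun _ => s t)
  have hconst : ∀ v : EuclideanSpace ℝ (Fin n), ‖(fun _ : Fin m => v)‖ ≤ ‖v‖ := fun v =>
    (pi_norm_le_iff_of_nonneg (norm_nonneg _)).2 fun _ => le_rfl
  rw [Fintype.card_fin] at h3
  rw [Real.norm_of_nonneg (by positivity), ← mul_assoc]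
  refine h3.trans ?_
  gcongr
  · exact max_le ((hconst _).trans (by simp)) ((hconst _).trans (by simp))
  · exact hconst (y t - s t)

end RealSystem

/-! ### Resonances -/

section Resonance

variable {μ : ℕ → ℝ}

/-- The tuple is nonempty because the empty sum `0` is not assumed to be a value of `μ`. -/
theorem exists_sum_eq_of_closed_under_add (hadd : ∀ a ∈ Set.range μ, ∀ b ∈ Set.range μ,
    a + b ∈ Set.range μ) (m : ℕ) (r : Fin (m + 1) → ℕ) : ∃ k, ∑ i, μ (r i) = μ k := by
  induction m with
  | zero => exact ⟨r 0, by simp⟩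
  | succ m ih =>
    obtain ⟨k, hk⟩ := ih fun i => r i.succ
    obtain ⟨l, hl⟩ := hadd _ ⟨r 0, rfl⟩ _ ⟨k, rfl⟩
    exact ⟨l, by rw [Fin.sum_univ_succ, hk, hl]⟩

/-- There are at least two summands, all positive. Hence the equation for `y_k` involves only
earlier terms, and the recursion is well founded. -/
theorem lt_of_mem_sumIndices (hpos : ∀ k, 0 < μ k) (hmono : StrictMono μ) {k : ℕ}
    {p : Σ m : ℕ, Fin m → ℕ} (hp : p ∈ sumIndices μ k) (i : Fin p.1) : p.2 i < k := by
  obtain ⟨h2, hsum⟩ := hp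
  have : Nontrivial (Fin p.1) := Fin.nontrivial_iff_two_le.2 h2
  obtain ⟨j, hj⟩ := exists_ne i
  rw [← hmono.lt_iff_lt, ← hsum]
  exact Finset.single_lt_sum hj (Finset.mem_univ i) (Finset.mem_univ j) (hpos _)
    fun _ _ _ => (hpos _).le

theorem mul_le_of_mem_sumIndices (hmono : StrictMono μ) {k : ℕ} {p : Σ m : ℕ, Fin m → ℕ}
    (hp : p ∈ sumIndices μ k) : p.1 * μ 0 ≤ μ k := by
  rw [← hp.2]
  calc (p.1 : ℝ) * μ 0 = ∑ _i : Fin p.1, μ 0 := by simp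
    _ ≤ _ := Finset.sum_le_sum fun i _ => hmono.monotone (Nat.zero_le _)

variable {E : Type*} [AddCommGroup E]

/-- The sum over the tuples with entries below `N` and length at most `M`, without the resonant
sums of index at most `N`, is the sum over the tuples of weight greater than `μ N`. -/
theorem sum_sigma_sub_sum_sumIndices (hpos : ∀ k, 0 < μ k) (hmono : StrictMono μ)
    (hadd : ∀ a ∈ Set.range μ, ∀ b ∈ Set.range μ, a + b ∈ Set.range μ) {N M : ℕ}
    (hM : μ N ≤ M * μ 0) (F : (Σ m : ℕ, Fin m → ℕ) → E) :
    ∑ p ∈ (Finset.Icc 2 M).sigma fun m => Fintype.piFinset fun _ : Fin m => Finset.range N, F p -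
      ∑ k ∈ Finset.range (N + 1), ∑ᶠ p ∈ sumIndices μ k, F p =
    ∑ p ∈ ((Finset.Icc 2 M).sigma fun m => Fintype.piFinset fun _ : Fin m => Finset.range N) with
      μ N < ∑ i, μ (p.2 i), F p := by
  classical
  set T := (Finset.Icc 2 M).sigma fun m => Fintype.piFinset fun _ : Fin m => Finset.range N with hT
  have h1 : ∀ k ∈ Finset.range (N + 1), ∑ᶠ p ∈ sumIndices μ k, F p =
      ∑ p ∈ T, if ∑ i, μ (p.2 i) = μ k then F p else 0 := by
    intro k hk
    have hkN : k ≤ N := Nat.lt_succ_iff.1 (Finset.mem_range.1 hk)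
    rw [← Finset.sum_filter, finsum_mem_eq_finite_toFinset_sum _ (sumIndices_finite hpos hmono k)]
    refine Finset.sum_congr (Finset.ext fun p => ?_) fun _ _ => rfl
    rw [Set.Finite.mem_toFinset, Finset.mem_filter, hT, Finset.mem_sigma, Finset.mem_Icc,
      Fintype.mem_piFinset]
    constructor
    · intro hp
      refine ⟨⟨⟨hp.1, ?_⟩, fun i => Finset.mem_range.2
        ((lt_of_mem_sumIndices hpos hmono hp i).trans_le hkN)⟩, hp.2⟩
      have := (mul_le_of_mem_sumIndices hmono hp).trans ((hmono.monotone hkN).trans hM)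
      exact_mod_cast le_of_mul_le_mul_right this (hpos 0)
    · exact fun hp => ⟨hp.1.1.1, hp.2⟩
  rw [Finset.sum_congr rfl h1, Finset.sum_comm, ← Finset.sum_sub_distrib, Finset.sum_filter]
  refine Finset.sum_congr rfl fun p hp => ?_
  obtain ⟨m, r⟩ := p
  have hm : 2 ≤ m := (Finset.mem_Icc.1 (Finset.mem_sigma.1 hp).1).1
  obtain ⟨m, rfl⟩ := Nat.exists_eq_add_of_le' (show 1 ≤ m by omega)
  -- Each tuple has weight `μ l` for a single `l`, so it is cancelled by the resonant sum of index
  -- `l` if `l ≤ N` and survives otherwise.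
  obtain ⟨l, hl⟩ := exists_sum_eq_of_closed_under_add hadd m r
  simp only [hl, hmono.injective.eq_iff, hmono.lt_iff_lt, Finset.sum_ite_eq, Finset.mem_range]
  by_cases h : l < N + 1
  · rw [if_pos h, if_neg (by omega), sub_self]
  · rw [if_neg h, if_pos (by omega), sub_zero]

end Resonance

/-- Dependent choice for a property `P N` that reads only the entries up to `N`: later choices
cannot spoil earlier instances. -/
theorem exists_seq_of_forall_exists_update {α : Type*} [Inhabited α] (P : ℕ → (ℕ → α) → Prop)
    (hcongr : ∀ N a b, (∀ k ≤ N, a k = b k) → P N a → P N b)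
    (step : ∀ N a, (∀ k < N, P k a) → ∃ z, P N (Function.update a N z)) : ∃ a, ∀ N, P N a := by
  choose! z hz using step
  -- `s N` is the sequence after `N` choices, with `default` from entry `N` on. Entry `k` is final
  -- from stage `k + 1`.
  let s : ℕ → ℕ → α := fun N => Nat.rec (fun _ => default) (fun N a => Function.update a N (z N a)) N
  have hs : ∀ N, s (N + 1) = Function.update (s N) N (z N (s N)) := fun N => rfl
  have hst : ∀ k N, k < N → s N k = s (k + 1) k := by
    intro k N hk
    induction N, hk using Nat.le_induction with
    | base => rfl
    | succ N hN ih => rw [hs, Function.update_of_ne (by omega : k ≠ N), ih]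
  have hP : ∀ N, ∀ k < N, P k (s N) := by
    intro N
    induction N with
    | zero => exact fun k hk => absurd hk (by omega)
    | succ N ih =>
      intro k hk
      rcases Nat.lt_succ_iff_lt_or_eq.1 hk with h | rfl
      · refine hcongr k (s N) _ (fun j hj => ?_) (ih k h)
        rw [hs, Function.update_of_ne (by omega : j ≠ N)]
      · rw [hs]
        exact hz k (s k) ih
  refine ⟨fun k => s (k + 1) k, fun N => hcongr N (s (N + 1)) _ (fun k hk => ?_)
    (hP (N + 1) N (by omega))⟩
  exact hst k (N + 1) (by omega)

/-! ### Expansion of the nonlinear term along the solution -/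

section Nonlinear

variable {n : ℕ} {G : EuclideanSpace ℝ (Fin n) → EuclideanSpace ℝ (Fin n)}
  {Gm : ℕ → EuclideanSpace ℝ (Fin n) → EuclideanSpace ℝ (Fin n)}
  {𝒢 : (m : ℕ) → MultilinearMap ℝ (fun _ : Fin m => EuclideanSpace ℝ (Fin n))
    (EuclideanSpace ℝ (Fin n))}

/-- The expansion to order two already gives `G(x) = O(|x|²)`. -/
theorem HasPolyExpansionAtZero.eventually_norm_le (hG : HasPolyExpansionAtZero G Gm)
    (h𝒢 : ∀ m, 2 ≤ m → ∀ x, Gm m x = 𝒢 m (fun _ => x)) {ε : ℝ} (hε : 0 < ε) :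
    ∀ᶠ x in 𝓝 0, ‖G x‖ ≤ ε * ‖x‖ := by
  obtain ⟨δ, hδ, hO⟩ := hG.2 2 le_rfl
  obtain ⟨C, hC, hb⟩ := hO.exists_nonneg
  obtain ⟨K, hK, hKb⟩ := (𝒢 2).exists_norm_le
  have hsmall : ∀ᶠ x : EuclideanSpace ℝ (Fin n) in 𝓝 0, (C + K) * ‖x‖ < ε := by
    have : Tendsto (fun x : EuclideanSpace ℝ (Fin n) => (C + K) * ‖x‖) (𝓝 0) (𝓝 0) := by
      simpa using (tendsto_norm_zero (E := EuclideanSpace ℝ (Fin n))).const_mul (C + K)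
    exact this.eventually_lt_const hε
  have hone : ∀ᶠ x : EuclideanSpace ℝ (Fin n) in 𝓝 0, ‖x‖ < 1 :=
    (tendsto_norm_zero (E := EuclideanSpace ℝ (Fin n))).eventually_lt_const one_pos
  filter_upwards [hb.bound, hsmall, hone] with x h1 h2 h3
  rw [Finset.Icc_self, Finset.sum_singleton, h𝒢 2 le_rfl] at h1
  have h4 := hKb fun _ => x
  rw [Finset.prod_const, Finset.card_univ, Fintype.card_fin] at h4
  have h5 : ‖x‖ ^ (((2 : ℕ) : ℝ) + δ) ≤ ‖x‖ ^ 2 := by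
    rw [← Real.rpow_natCast ‖x‖ 2]
    exact Real.rpow_le_rpow_of_exponent_ge_of_imp (norm_nonneg x) h3.le (by linarith)
      fun _ h => absurd h (by positivity)
  rw [Real.norm_of_nonneg (by positivity)] at h1
  have h6 := norm_sub_norm_le (G x) (𝒢 2 fun _ => x)
  have h7 := mul_le_mul_of_nonneg_left h5 hC
  calc ‖G x‖ ≤ (C + K) * ‖x‖ * ‖x‖ := by nlinarith
    _ ≤ ε * ‖x‖ := by gcongr

theorem HasPolyExpansionAtZero.isBigO_comp (hG : HasPolyExpansionAtZero G Gm)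
    {M : ℕ} (hM : 2 ≤ M) {b : ℝ} {y : ℝ → EuclideanSpace ℝ (Fin n)} (hy0 : Tendsto y atTop (𝓝 0))
    (hy : y =O[atTop] fun t => Real.exp (-b * t)) :
    (fun t => G (y t) - ∑ m ∈ Finset.Icc 2 M, Gm m (y t)) =O[atTop]
      fun t => Real.exp (-(M * b) * t) := by
  obtain ⟨δ, hδ, hO⟩ := hG.2 M hM
  refine (hO.comp_tendsto hy0).trans ?_
  have h1 : (fun t => ‖y t‖ ^ M) =O[atTop] fun t => Real.exp (-(M * b) * t) := by
    refine (hy.norm_left.pow M).congr_right fun t => ?_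
    rw [← Real.exp_nat_mul]
    ring_nf
  refine IsBigO.trans (IsBigO.of_bound 1 ?_) h1
  have hone : ∀ᶠ t in atTop, ‖y t‖ < 1 := by
    have := hy0.norm
    rw [norm_zero] at this
    exact this.eventually_lt_const one_pos
  filter_upwards [hone] with t ht
  simp only [Function.comp]
  rw [Real.norm_of_nonneg (by positivity), Real.norm_of_nonneg (by positivity), one_mul,
    ← Real.rpow_natCast ‖y t‖ M]
  exact Real.rpow_le_rpow_of_exponent_ge_of_imp (norm_nonneg _) ht.le (by linarith)
    fun _ h => absurd h (by positivity)

/-- The expansion of `G (y t)` up to index `N`, from that of `y` up to index `N - 1`. -/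
theorem nonlinear_expansion (hG : HasPolyExpansionAtZero G Gm)
    (h𝒢 : ∀ m, 2 ≤ m → ∀ x, Gm m x = 𝒢 m (fun _ => x)) {μ : ℕ → ℝ} (hpos : ∀ k, 0 < μ k)
    (hmono : StrictMono μ)
    (hadd : ∀ a ∈ Set.range μ, ∀ b ∈ Set.range μ, a + b ∈ Set.range μ)
    {y : ℝ → EuclideanSpace ℝ (Fin n)} (hy0 : Tendsto y atTop (𝓝 0))
    (hy : ∀ b < μ 0, y =O[atTop] fun t => Real.exp (-b * t))
    {N : ℕ} {a : ℕ → ℝ → EuclideanSpace ℝ (Fin n)} (ha : ∀ k < N, a k ∈ RealExpClass (-μ k) n)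
    {ν : ℝ} (hν : μ N - μ 0 < ν)
    (hya : (fun t => y t - ∑ k ∈ Finset.range N, a k t) =O[atTop] fun t => Real.exp (-ν * t)) :
    ∃ η, μ N < η ∧ (fun t => G (y t) - ∑ k ∈ Finset.range (N + 1),
      ∑ᶠ p ∈ sumIndices μ k, 𝒢 p.1 (fun i => a (p.2 i) t)) =O[atTop]
        fun t => Real.exp (-η * t) := by
  have hμ0 := hpos 0
  -- `b > μ N - ν` makes `ν + b` exceed `μ N`, and `b > μ 0 / 2` makes `M b` exceed it, since `M` is
  -- chosen with `M μ 0 > 2 μ N`.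
  obtain ⟨b, hb, hbμ⟩ := exists_between
    (max_lt (by linarith : μ 0 / 2 < μ 0) (by linarith : μ N - ν < μ 0))
  have hb1 : μ 0 / 2 < b := (le_max_left _ _).trans_lt hb
  have hb2 : μ N - ν < b := (le_max_right _ _).trans_lt hb
  have hb0 : 0 < b := by linarith
  obtain ⟨M₀, hM₀⟩ := exists_nat_gt (2 * μ N / μ 0)
  set M := max 2 M₀ with hM
  have hMμ : 2 * μ N < M * μ 0 := by
    rw [← div_lt_iff₀ hμ0]
    exact hM₀.trans_le (by exact_mod_cast le_max_right _ _)
  have hμN := hpos N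
  have hMb : μ N < M * b := by
    have hM0 : (0 : ℝ) < M := by exact_mod_cast (by omega : 0 < M)
    nlinarith
  -- A weight above `μ N` is at least `μ (N + 1)`, so `θ` is a rate that all nonresonant terms beat
  -- strictly.
  obtain ⟨θ, hθ1, hθ2⟩ := exists_between (hmono (Nat.lt_succ_self N))
  set s : ℝ → EuclideanSpace ℝ (Fin n) := fun t => ∑ k ∈ Finset.range N, a k t with hs
  have hsO : s =O[atTop] fun t => Real.exp (-b * t) :=
    IsBigO.fun_sum fun k hk => isBigO_of_mem_RealExpClass
      (hbμ.trans_le (hmono.monotone (Nat.zero_le k))) (ha k (Finset.mem_range.1 hk))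
  set η := min (M * b) (min (ν + b) θ) with hη
  refine ⟨η, lt_min hMb (lt_min (by linarith) hθ1), ?_⟩
  have h1 := (hG.isBigO_comp (le_max_left 2 M₀) hy0 (hy b hbμ)).trans
    (isBigO_exp_neg_of_le (min_le_left (M * b) (min (ν + b) θ)))
  have h2 : (fun t => ∑ m ∈ Finset.Icc 2 M, ((𝒢 m fun _ => y t) - 𝒢 m fun _ => s t)) =O[atTop]
      fun t => Real.exp (-η * t) :=
    IsBigO.fun_sum fun m hm => (multilinear_diag_sub_isBigO (Finset.mem_Icc.1 hm).1 (𝒢 m) hb0.le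
      (hy b hbμ) hsO hya).trans
        (isBigO_exp_neg_of_le ((min_le_right _ _).trans (min_le_left _ _)))
  set T := (Finset.Icc 2 M).sigma fun m => Fintype.piFinset fun _ : Fin m => Finset.range N with hT
  have h3 : (fun t => ∑ p ∈ T with μ N < ∑ i, μ (p.2 i), 𝒢 p.1 fun i => a (p.2 i) t) =O[atTop]
      fun t => Real.exp (-η * t) := by
    refine IsBigO.fun_sum fun p hp => ?_
    obtain ⟨hpT, hlt⟩ := Finset.mem_filter.1 hp
    obtain ⟨hp1, hp2⟩ := Finset.mem_sigma.1 hpT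
    have hmem := multilinear_mem_RealExpClass (𝒢 p.1) (fun i => μ (p.2 i)) (fun i => a (p.2 i))
      fun i => ha _ (Finset.mem_range.1 (Fintype.mem_piFinset.1 hp2 i))
    refine isBigO_of_mem_RealExpClass ?_ hmem
    obtain ⟨m, r⟩ := p
    have hm : 2 ≤ m := (Finset.mem_Icc.1 hp1).1
    obtain ⟨m, rfl⟩ := Nat.exists_eq_add_of_le' (show 1 ≤ m by omega)
    obtain ⟨l, hl⟩ := exists_sum_eq_of_closed_under_add hadd m r
    simp only [hl, hmono.lt_iff_lt] at hlt ⊢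
    exact ((min_le_right _ _).trans (min_le_right _ _)).trans_lt
      (hθ2.trans_le (hmono.monotone hlt))
  -- The three errors are the Taylor remainder of `G`, the replacement of `y` by the partial sum
  -- `s`, and the tuples of weight above `μ N`.
  refine ((h1.add h2).add h3).congr_left fun t => ?_
  rw [← sum_sigma_sub_sum_sumIndices hpos hmono hadd (by linarith : μ N ≤ M * μ 0)
    (fun p => 𝒢 p.1 fun i => a (p.2 i) t), Finset.sum_sub_distrib, Finset.sum_sigma]
  have h4 : ∀ m ∈ Finset.Icc 2 M, (𝒢 m fun _ => s t) =
      ∑ r ∈ Fintype.piFinset fun _ : Fin m => Finset.range N, 𝒢 m fun i => a (r i) t :=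
    fun m _ => (𝒢 m).map_sum_finset (fun _ k => a k t) fun _ => Finset.range N
  rw [Finset.sum_congr rfl h4, Finset.sum_congr rfl fun m hm => h𝒢 m (Finset.mem_Icc.1 hm).1 (y t)]
  abel

end Nonlinear

theorem resonant_sum_mem_RealExpClass {n : ℕ}
    {𝒢 : (m : ℕ) → MultilinearMap ℝ (fun _ : Fin m => EuclideanSpace ℝ (Fin n))
      (EuclideanSpace ℝ (Fin n))}
    {μ : ℕ → ℝ} (hpos : ∀ k, 0 < μ k) (hmono : StrictMono μ) {N : ℕ}
    {a : ℕ → ℝ → EuclideanSpace ℝ (Fin n)} (ha : ∀ k < N, a k ∈ RealExpClass (-μ k) n) :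
    (fun t => ∑ᶠ p ∈ sumIndices μ N, 𝒢 p.1 (fun i => a (p.2 i) t)) ∈ RealExpClass (-μ N) n := by
  simp only [finsum_mem_eq_finite_toFinset_sum _ (sumIndices_finite hpos hmono N)]
  refine sum_mem_RealExpClass _ _ fun p hp => ?_
  have hp' : p ∈ sumIndices μ N := (Set.Finite.mem_toFinset _).1 hp
  rw [← hp'.2]
  exact multilinear_mem_RealExpClass (𝒢 p.1) (fun i => μ (p.2 i)) (fun i => a (p.2 i))
    fun i => ha _ (lt_of_mem_sumIndices hpos hmono hp' i)

/-! ### Recursive construction of the expansion -/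

theorem theorem10p5
    (n : ℕ) (hn : 0 < n)
    -- the linear part
    (A : Matrix (Fin n) (Fin n) ℝ)
    (hA : ∀ z ∈ complexSpectrum A, 0 < z.re)
    -- the nonlinear part
    (G : EuclideanSpace ℝ (Fin n) → EuclideanSpace ℝ (Fin n))
    (hGlip : LocallyLipschitz G)
    (Gm : ℕ → EuclideanSpace ℝ (Fin n) → EuclideanSpace ℝ (Fin n))
    (hG : HasPolyExpansionAtZero G Gm)
    (𝒢 : (m : ℕ) → MultilinearMap ℝ (fun _ : Fin m => EuclideanSpace ℝ (Fin n))
      (EuclideanSpace ℝ (Fin n)))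
    (h𝒢 : ∀ m, 2 ≤ m → ∀ x, Gm m x = 𝒢 m (fun _ => x))
    -- the forcing function and its expansion
    (f : ℝ → EuclideanSpace ℝ (Fin n))
    (Tf : ℝ) (hTf : 0 ≤ Tf) (hf : ContinuousOn f (Set.Ici Tf))
    (μ : ℕ → ℝ) (hμpos : ∀ k, 0 < μ k) (hμmono : StrictMono μ)
    (hμdiv : Tendsto μ atTop atTop)
    (hμadd : ∀ a ∈ Set.range μ, ∀ b ∈ Set.range μ, a + b ∈ Set.range μ)
    (hμspec : Complex.re '' complexSpectrum A ⊆ Set.range μ)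
    (fs : ℕ → ℝ → EuclideanSpace ℝ (Fin n))
    (hfs : ∀ k, fs k ∈ RealExpClass (-μ k) n)
    (hfexp : HasExpExpansion μ (fun t => toComplexVec (f t)) (fun k t => toComplexVec (fs k t)))
    -- the decaying solution
    (y : ℝ → EuclideanSpace ℝ (Fin n))
    (T₀ : ℝ) (hT₀ : 0 ≤ T₀) (hyC1 : ContDiffOn ℝ 1 y (Set.Ioi T₀))
    (hysol : ∀ t, T₀ < t →
      HasDerivAt y (-(Matrix.toEuclideanLin A (y t)) + G (y t) + f t) t)
    (hylim : Tendsto y atTop (𝓝 0)) :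
    ∃ ys : ℕ → ℝ → EuclideanSpace ℝ (Fin n),
      (∀ k, ys k ∈ RealExpClass (-μ k) n) ∧
      HasExpExpansion μ (fun t => toComplexVec (y t)) (fun k t => toComplexVec (ys k t)) ∧
      ∀ k, Differentiable ℝ (ys k) ∧
        ∀ t : ℝ, deriv (ys k) t + Matrix.toEuclideanLin A (ys k t) =
          (∑ᶠ p ∈ sumIndices μ k, 𝒢 p.1 (fun i => ys (p.2 i) t)) + fs k t := by

  have hEquiv : ∀ {g : ℝ → EuclideanSpace ℝ (Fin n)} {gs : ℕ → ℝ → EuclideanSpace ℝ (Fin n)}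
      {N : ℕ} {ν : ℝ},
      ((fun t => toComplexVec (g t) - ∑ k ∈ Finset.range N, toComplexVec (gs k t)) =O[atTop]
        fun t => Real.exp (-ν * t)) ↔
      (fun t => g t - ∑ k ∈ Finset.range N, gs k t) =O[atTop] fun t => Real.exp (-ν * t) := by
    intro g gs N ν
    rw [← isBigO_norm_left, ← isBigO_norm_left (f' := fun t => g t - _)]
    refine isBigO_congr (Eventually.of_forall fun t => ?_) EventuallyEq.rfl
    simp only [← toComplexVecₗᵢ_apply, ← map_sum, ← map_sub, LinearIsometry.norm_map]
  have hf' : ∀ N, ∃ ν, μ N < ν ∧ (fun t => f t - ∑ k ∈ Finset.range (N + 1), fs k t) =O[atTop]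
      fun t => Real.exp (-ν * t) := fun N => by
    obtain ⟨ν, hν, hO⟩ := hfexp.2.2.2.2 N
    exact ⟨ν, hν, hEquiv.1 hO⟩
  have hspec : ∀ z ∈ complexSpectrum A, ∃ k, z.re = μ k := fun z hz => by
    obtain ⟨k, hk⟩ := hμspec ⟨z, hz, rfl⟩
    exact ⟨k, hk.symm⟩
  have hsol : ∀ᶠ t in atTop,
      HasDerivAt y (-(Matrix.toEuclideanLin A (y t)) + G (y t) + f t) t :=
    (eventually_gt_atTop T₀).mono hysol
  have hydecay : ∀ b < μ 0, y =O[atTop] fun t => Real.exp (-b * t) := by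
    intro b hb
    refine isBigO_exp_of_tendsto_zero hb (fun z hz => ?_)
      (fun ε hε => hG.eventually_norm_le h𝒢 hε) ?_ hylim hsol
    · obtain ⟨k, hk⟩ := hspec z hz
      exact hk ▸ hμmono.monotone (Nat.zero_le k)
    · obtain ⟨ν, hν, hO⟩ := hf' 0
      refine ((hO.trans (isBigO_exp_neg_of_le (hb.trans hν).le)).add
        (isBigO_of_mem_RealExpClass hb (hfs 0))).congr_left fun t => ?_
      simp
  suffices h : ∃ a : ℕ → ℝ → EuclideanSpace ℝ (Fin n), ∀ N, a N ∈ RealExpClass (-μ N) n ∧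
      (∀ t, HasDerivAt (a N) (-(Matrix.toEuclideanLin A (a N t)) +
        ((∑ᶠ p ∈ sumIndices μ N, 𝒢 p.1 (fun i => a (p.2 i) t)) + fs N t)) t) ∧
      ∃ ν, μ N < ν ∧ (fun t => y t - ∑ k ∈ Finset.range (N + 1), a k t) =O[atTop]
        fun t => Real.exp (-ν * t) by
    obtain ⟨a, ha⟩ := h
    refine ⟨a, fun k => (ha k).1, ⟨fun k => (hμpos k).le, hμmono, hμdiv, fun k => (ha k).1,
      fun N => ?_⟩, fun k => ⟨fun t => ((ha k).2.1 t).differentiableAt, fun t => ?_⟩⟩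
    · obtain ⟨ν, hν, hO⟩ := (ha N).2.2
      exact ⟨ν, hν, hEquiv.2 hO⟩
    · rw [((ha k).2.1 t).deriv]
      abel
  refine exists_seq_of_forall_exists_update _ ?_ ?_
  · rintro N a b hab ⟨h1, h2, ν, hν, h3⟩
    rw [hab N le_rfl] at h1 h2
    refine ⟨h1, fun t => ?_, ν, hν, h3.congr_left fun t => ?_⟩
    · convert h2 t using 3
      refine finsum_mem_congr rfl fun p hp => ?_
      congr 1
      ext1 i
      rw [hab _ (lt_of_mem_sumIndices hμpos hμmono hp i).le]
    · congr 1
      exact Finset.sum_congr rfl fun k hk => by rw [hab k (Nat.lt_succ_iff.1 (Finset.mem_range.1 hk))]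
  intro N a ha
  -- The rate `ν` is placed above all earlier `μ k` and below `μ N`, to fit the spectral gap. The
  -- bound `ν > μ N - μ 0` is what the nonlinear terms require.
  obtain ⟨ν, hν1, hν2, hν3, hνO⟩ : ∃ ν, μ N - μ 0 < ν ∧ ν < μ N ∧ (∀ k < N, μ k < ν) ∧
      (fun t => y t - ∑ k ∈ Finset.range N, a k t) =O[atTop] fun t => Real.exp (-ν * t) := by
    have h0 := hμpos 0
    rcases N with _ | N
    · refine ⟨μ 0 / 2, by linarith, by linarith, by simp, ?_⟩
      simpa using hydecay (μ 0 / 2) (by linarith)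
    · obtain ⟨ν', hν', hO⟩ := (ha N (Nat.lt_succ_self N)).2.2
      obtain ⟨ν, h1, h2⟩ := exists_between (lt_min hν' (hμmono (Nat.lt_succ_self N)))
      refine ⟨ν, ?_, h2.trans_le (min_le_right _ _), fun k hk =>
        (hμmono.monotone (Nat.lt_succ_iff.1 hk)).trans_lt h1,
        hO.trans (isBigO_exp_neg_of_le (h2.le.trans (min_le_left _ _)))⟩
      -- `μ N + μ 0` is a value of `μ` larger than `μ N`, hence at least `μ (N + 1)`.
      obtain ⟨l, hl⟩ := hμadd _ ⟨N, rfl⟩ _ ⟨0, rfl⟩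
      have h3 : μ (N + 1) ≤ μ l :=
        hμmono.monotone (Nat.succ_le_of_lt (hμmono.lt_iff_lt.1 (by linarith)))
      linarith
  have haN : ∀ k < N, a k ∈ RealExpClass (-μ k) n := fun k hk => (ha k hk).1
  obtain ⟨η₁, hη₁, hGO⟩ := nonlinear_expansion hG h𝒢 hμpos hμmono hμadd hylim hydecay haN hν1 hνO
  obtain ⟨η₂, hη₂, hfO⟩ := hf' N
  obtain ⟨z, hz, hz', ρ, hρ, hzO⟩ := exists_real_exp_asymptotics (A := A) hν2 (lt_min hη₁ hη₂)
    (fun z hz => by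
      obtain ⟨k, hk⟩ := hspec z hz
      rcases lt_or_ge k N with h | h
      · exact Or.inl (hk ▸ hν3 k h)
      · exact Or.inr (hk ▸ hμmono.monotone h))
    (add_mem_RealExpClass (resonant_sum_mem_RealExpClass (𝒢 := 𝒢) hμpos hμmono haN) (hfs N)) hνO
    ((hGO.trans (isBigO_exp_neg_of_le (min_le_left _ _))).add
      (hfO.trans (isBigO_exp_neg_of_le (min_le_right _ _))))
    -- The sums in `hGO` and `hfO` run up to `N`, the subtracted equations only up to `N - 1`. The
    -- difference, the terms of index `N`, is the forcing in the equation for the new term.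
    (hsol.mono fun t ht => by
      refine (ht.sub (HasDerivAt.fun_sum fun k hk =>
        (ha k (Finset.mem_range.1 hk)).2.1 t)).congr_deriv ?_
      rw [Finset.sum_add_distrib, Finset.sum_add_distrib, Finset.sum_neg_distrib, map_sub, map_sum,
        Finset.sum_range_succ, Finset.sum_range_succ]
      abel)
  have hupd : ∀ k < N, Function.update a N z k = a k := fun k hk =>
    Function.update_of_ne hk.ne _ _
  have hself : Function.update a N z N = z := Function.update_self _ _ _
  refine ⟨z, by rwa [hself], fun t => ?_, ρ, hρ, hzO.congr_left fun t => ?_⟩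
  · rw [hself]
    convert hz' t using 3
    refine finsum_mem_congr rfl fun p hp => ?_
    congr 1
    ext1 i
    rw [hupd _ (lt_of_mem_sumIndices hμpos hμmono hp i)]
  · rw [Finset.sum_range_succ, hself, sub_sub]
    congr 2
    exact Finset.sum_congr rfl fun k hk => by rw [hupd k (Finset.mem_range.1 hk)]
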